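/- Let $p$ be a prime, $e\ge 2$, and let $\chi$ be a primitive Dirichlet character of conductor $m$ with $\chi^3=\mathbf 1$ (possibly trivial) and $p\nmid m$. Let $\tilde\chi_p:\mathbb Q_p^\times\to\mathbb C^\times$ be the local component at $p$ of the idele class character $\tilde\chi:\mathbb A^\times=\mathbb R_{>0}\cdot\widehat{\mathbb Z}^\times\cdot\mathbb Q^\times\to\mathbb C^\times$, $ruq\mapsto\chi(u\bmod m)$, and let $L_p(s,\chi)=(1-\chi(p)p^{-s})^{-1}$ be the local factor of $L(s,\chi)$ at $p$. For a ring $R$ let $V_R$ be the set of binary cubic forms $x(u,v)=x_1u^3+x_2u^2v+x_3uv^2+x_4v^3$ over $R$, identified with $(x_1,x_2,x_3,x_4)\in R^4$, with the action of $\mathrm{GL}_2(R)$ by $(g\cdot x)(u,v)=(\det g)^{-1}x(\alpha u+\gamma v,\beta u+\delta v)$ for $g=\begin{pmatrix}\alpha&\beta\\ \gamma&\delta\end{pmatrix}$. For $a\in V_{\mathbb Z/p^e\mathbb Z}$ let $\Phi_{p,a}:V_{\mathbb Q_p}\to\{0,1\}$ be the characteristic function of the set of $x\in V_{\mathbb Z_p}$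 reducing to $a$ modulo $p^e$. For $\psi$ equal to $\mathbf 1$ or $\chi^{-1}$, with local component $\tilde\psi_p$, let $\mathcal M_{p,\psi}\Phi(x)=\int_{\mathrm{GL}_2(\mathbb Z_p)}\tilde\psi_p(\det g)\Phi(gx)\,dg$, where $dg$ is the Haar measure of total volume $1$, and let $\mathcal M_p=\mathcal M_{p,\mathbf 1}$. With the Haar measures $du$ on $\mathbb Q_p$ and $d^\times t$ on $\mathbb Q_p^\times$ normalized by $\mathrm{vol}(\mathbb Z_p)=1$ and $\mathrm{vol}(\mathbb Z_p^\times)=1$, put $$\mathcal B_{p^e}(a)=p^{4e}(1-p^{-2})\int_{\mathbb Q_p^\times\times\mathbb Q_p^2}|t|_p^2\,\mathcal M_p\Phi_{p,a}(0,t,u_3,u_4)\,d^\times t\,du_3\,du_4,$$ $$\mathcal C_{p^e}(a,\chi)=p^{4e}L_p(\tfrac13,\chi^{-1})^{-1}\int_{\mathbb Q_p^\times\times\mathbb Q_p^3}\tilde\chi_p(t)|t|_p^{1/3}\,\mathcal M_{p,\chi^{-1}}\Phi_{p,a}(t,u_2,u_3,u_4)\,d^\times t\,du_2\,du_3\,du_4.$$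 We say that $a\in V_{\mathbb Z/p^e\mathbb Z}$ is of type $(3)$ if $a\bmod p$ has no root in $\mathbb P^1(\mathbb F_p)$; of type $(21)$ if $a\bmod p$ is the product of a nonzero linear form and an irreducible quadratic form over $\mathbb F_p$; of type $(111)$ if $a\bmod p$ is nonzero and has three distinct roots in $\mathbb P^1(\mathbb F_p)$. Writing $R=\mathbb Z/p^2\mathbb Z$, we say that $a$ is of type $(1^21_{\max})$ if $a\bmod p^2$ lies in the $\mathrm{GL}_2(R)$-orbit of some $(0,a_2,a_3,a_4)$ with $a_2\in R^\times$, $a_3\in pR$, $a_4\in pR^\times$, and of type $(1^3_{\max})$ if $a\bmod p^2$ lies in the $\mathrm{GL}_2(R)$-orbit of some $(a_1,a_2,a_3,a_4)$ with $a_1\in R^\times$, $a_2,a_3\in pR$, $a_4\in pR^\times$. We call $a$ maximal if it is of one of these five types. If $a\in V_{\mathbb Z/p^e\mathbb Z}$ is maximal, then both integrals over $\mathbb Q_p^\times\times\mathbb Q_p^n$ above converge absolutely, and $\mathcal B_{p^e}(a)$ and $(1-p^{-2})\mathcal C_{p^e}(a,\chi)$ are given by $$\begin{array}{c|c|l} \text{type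 of }a&\mathcal B_{p^e}(a)&(1-p^{-2})\,\mathcal C_{p^e}(a,\chi)\\ \hline (3)&0&(1-\chi(p)^2p^{-1/3})(1+p^{-1})\\ (21)&1&1-\chi(p)^2p^{-4/3}\\ (111)&3&(1-\chi(p)p^{-2/3})(1+\chi(p)^2p^{-1/3})^2\\ (1^21_{\max})&1&(1+\chi(p)^2p^{-1/3})(1-\chi(p)p^{-2/3})\\ (1^3_{\max})&0&1-\chi(p)p^{-2/3} \end{array}$$ In particular, $\mathcal B_{p^e}(a)$ and $\mathcal C_{p^e}(a,\chi)$ depend only on the type of $a$. -/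

import Mathlib

open MeasureTheory

open scoped Topology LinearAlgebra.Projectivization

namespace CubicFormResidue

/-! ### Binary cubic forms and the twisted action of `GL₂` -/

/-- Binary cubic forms over `R`: the tuple `x` stands for
`x 0 * u^3 + x 1 * u^2 * v + x 2 * u * v^2 + x 3 * v^3`. -/
abbrev Form (R : Type*) := Fin 4 → R

/-- The value `x(u, v)` of a binary cubic form. -/
def eval {R : Type*} [CommRing R] (x : Form R) (u v : R) : R :=
  x 0 * u ^ 3 + x 1 * u ^ 2 * v + x 2 * u * v ^ 2 + x 3 * v ^ 3

/-- The twisted action of `GL₂(R)` on binary cubic forms, in coordinates: for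
`g = (α β; γ δ)`, `(g x)(u, v) = (det g)⁻¹ x(α u + γ v, β u + δ v)`. -/
def act {R : Type*} [CommRing R] (g : GL (Fin 2) R) (x : Form R) : Form R :=
  let α := g.val 0 0
  let β := g.val 0 1
  let γ := g.val 1 0
  let δ := g.val 1 1
  let d : R := ((Matrix.GeneralLinearGroup.det g)⁻¹ : Rˣ)
  ![d * (α ^ 3 * x 0 + α ^ 2 * β * x 1 + α * β ^ 2 * x 2 + β ^ 3 * x 3),
    d * (3 * α ^ 2 * γ * x 0 + (α ^ 2 * δ + 2 * α * β * γ) * x 1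
      + (β ^ 2 * γ + 2 * α * β * δ) * x 2 + 3 * β ^ 2 * δ * x 3),
    d * (3 * α * γ ^ 2 * x 0 + (β * γ ^ 2 + 2 * α * γ * δ) * x 1
      + (α * δ ^ 2 + 2 * β * γ * δ) * x 2 + 3 * β * δ ^ 2 * x 3),
    d * (γ ^ 3 * x 0 + γ ^ 2 * δ * x 1 + γ * δ ^ 2 * x 2 + δ ^ 3 * x 3)]

/-- The coordinate formula for the action agrees with the substitution formula. -/
theorem eval_act {R : Type*} [CommRing R] (g : GL (Fin 2) R) (x : Form R) (u v : R) :
    eval (act g x) u v = ((Matrix.GeneralLinearGroup.det g)⁻¹ : Rˣ) *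
      eval x (g.val 0 0 * u + g.val 1 0 * v) (g.val 0 1 * u + g.val 1 1 * v) := by
  simp only [eval, act, Matrix.cons_val]
  ring

/-- Reduction of a form over `ℤ/M` modulo a divisor `N` of `M`. -/
def reduce {M N : ℕ} (h : N ∣ M) (a : Form (ZMod M)) : Form (ZMod N) :=
  fun i => ZMod.castHom h (ZMod N) (a i)

/-! ### Orbit types modulo `p` and modulo `p ^ 2` -/

/-- The rational roots of a binary cubic form in the projective line over a field. -/
def projRoots {K : Type*} [Field K] (a : Form K) : Set (ℙ K (Fin 2 → K)) :=
  {P | eval a (P.rep 0) (P.rep 1) = 0}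

/-- Type `(3)`: no rational root. -/
def IsType3 {K : Type*} [Field K] (a : Form K) : Prop :=
  projRoots a = ∅

/-- Type `(21)`: the product of a nonzero linear form `r u + s v` and an irreducible quadratic
form `k u^2 + l u v + n v^2`, that is, exactly one rational root, and that root is simple. -/
def IsType21 {K : Type*} [Field K] (a : Form K) : Prop :=
  ∃ r s k l n : K, (r ≠ 0 ∨ s ≠ 0) ∧
    (∀ u v : K, k * u ^ 2 + l * u * v + n * v ^ 2 = 0 → u = 0 ∧ v = 0) ∧
    a = ![r * k, r * l + s * k, r * n + s * l, s * n]

/-- Type `(111)`: a nonzero form with three distinct rational roots. -/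
def IsType111 {K : Type*} [Field K] (a : Form K) : Prop :=
  a ≠ 0 ∧ (projRoots a).ncard = 3

/-- `p R` for `R = ℤ/p²`. -/
def pMul (p : ℕ) : Set (ZMod (p ^ 2)) := {x | ∃ y, x = p * y}

/-- `p Rˣ` for `R = ℤ/p²`. -/
def pMulUnits (p : ℕ) : Set (ZMod (p ^ 2)) := {x | ∃ y, IsUnit y ∧ x = p * y}

/-- Type `(1²1_max)` modulo `p²`: in the orbit of some `(0, a₂, a₃, a₄)` with `a₂ ∈ Rˣ`,
`a₃ ∈ pR`, `a₄ ∈ pRˣ`. -/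
def IsType121Max (p : ℕ) (a : Form (ZMod (p ^ 2))) : Prop :=
  ∃ (g : GL (Fin 2) (ZMod (p ^ 2))) (b : Form (ZMod (p ^ 2))),
    b 0 = 0 ∧ IsUnit (b 1) ∧ b 2 ∈ pMul p ∧ b 3 ∈ pMulUnits p ∧ a = act g b

/-- Type `(1³_max)` modulo `p²`: in the orbit of some `(a₁, a₂, a₃, a₄)` with `a₁ ∈ Rˣ`,
`a₂, a₃ ∈ pR`, `a₄ ∈ pRˣ`. -/
def IsType13Max (p : ℕ) (a : Form (ZMod (p ^ 2))) : Prop :=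
  ∃ (g : GL (Fin 2) (ZMod (p ^ 2))) (b : Form (ZMod (p ^ 2))),
    IsUnit (b 0) ∧ b 1 ∈ pMul p ∧ b 2 ∈ pMul p ∧ b 3 ∈ pMulUnits p ∧ a = act g b

/-- The five orbit types that make up the forms maximal at `p`. -/
inductive MaxType
  | t3
  | t21
  | t111
  | t121max
  | t13max

/-- `a ∈ V(ℤ/p^e)`, `e ≥ 2`, is of the given type. -/
def HasType {p e : ℕ} [Fact p.Prime] (he : 2 ≤ e) (a : Form (ZMod (p ^ e))) : MaxType → Prop
  | .t3 => IsType3 (reduce (dvd_pow_self p (show e ≠ 0 by omega)) a)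
  | .t21 => IsType21 (reduce (dvd_pow_self p (show e ≠ 0 by omega)) a)
  | .t111 => IsType111 (reduce (dvd_pow_self p (show e ≠ 0 by omega)) a)
  | .t121max => IsType121Max p (reduce (pow_dvd_pow p he) a)
  | .t13max => IsType13Max p (reduce (pow_dvd_pow p he) a)

/-- `a ∈ V(ℤ/p^e)` is maximal at `p`: it is of one of the five types. -/
def IsMaximal {p e : ℕ} [Fact p.Prime] (he : 2 ≤ e) (a : Form (ZMod (p ^ e))) : Prop :=
  ∃ σ : MaxType, HasType he a σ

/-! ### The idele class character attached to a Dirichlet character -/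

/-- The index set of the finite places of `ℚ`: the prime numbers. -/
@[ext]
structure FinPlace where
  /-- the prime number -/
  val : ℕ
  isPrime : val.Prime

instance factFinPlace (l : FinPlace) : Fact l.val.Prime := ⟨l.isPrime⟩

noncomputable instance decEqFinPlace : DecidableEq FinPlace := Classical.decEq _

/-- The reduction map from `∏ₗ ℤ_l` to `ℤ/m`, through the Chinese remainder theorem. -/
noncomputable def zhatMod (m : ℕ) [NeZero m] : (∀ l : FinPlace, ℤ_[l.val]) →+* ZMod m :=
  (ZMod.equivPi m (NeZero.ne m)).symm.toRingHom.comp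
    (RingHom.pi fun l : m.primeFactors =>
      have : Fact (l : ℕ).Prime := ⟨Nat.prime_of_mem_primeFactors l.2⟩
      (PadicInt.toZModPow (p := (l : ℕ)) (m.factorization l)).comp
        (Pi.evalRingHom (fun l : FinPlace => ℤ_[l.val])
          ⟨l, Nat.prime_of_mem_primeFactors l.2⟩))

/-- The idele with infinite component `y` and finite components `x l` is `r · u · q` with
`r` a positive real, `u ∈ ∏ₗ ℤ_lˣ` and `q ∈ ℚˣ` (embedded diagonally). -/
def IsIdeleDecomposition (y : ℝˣ) (x : ∀ l : FinPlace, ℚ_[l.val]ˣ)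
    (d : ℝ × (∀ l : FinPlace, ℤ_[l.val]ˣ) × ℚˣ) : Prop :=
  0 < d.1 ∧ (y : ℝ) = d.1 * ((d.2.2 : ℚ) : ℝ) ∧
    ∀ l : FinPlace, (x l : ℚ_[l.val]) = (((d.2.1 l : ℤ_[l.val]ˣ) : ℤ_[l.val]) : ℚ_[l.val]) * ((d.2.2 : ℚ) : ℚ_[l.val])

open Classical in
/-- The idele class character `χ̃`, `r · u · q ↦ χ(u mod m)`. Every idele has exactly one
decomposition `r · u · q`; families which are not ideles get the value `0`. -/
noncomputable def ideleChar {m : ℕ} [NeZero m] (χ : DirichletCharacter ℂ m)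
    (y : ℝˣ) (x : ∀ l : FinPlace, ℚ_[l.val]ˣ) : ℂ :=
  if h : ∃ d, IsIdeleDecomposition y x d then
    χ (zhatMod m fun l => ((h.choose.2.1 l : ℤ_[l.val]ˣ) : ℤ_[l.val]))
  else 0

/-- The local component `χ̃_p` on `ℚ_pˣ`: the restriction of `χ̃` to the ideles that
are `1` away from `p`. -/
noncomputable def localChar {m : ℕ} [NeZero m] (χ : DirichletCharacter ℂ m)
    (p : ℕ) [hp : Fact p.Prime] (t : ℚ_[p]ˣ) : ℂ :=
  ideleChar χ 1 (Pi.mulSingle (M := fun l : FinPlace => ℚ_[l.val]ˣ) ⟨p, hp.out⟩ t)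

/-- The local factor `L_p(s, χ)`. -/
noncomputable def localL {m : ℕ} (s : ℂ) (χ : DirichletCharacter ℂ m) (p : ℕ) : ℂ :=
  if p ∣ m then 1 else (1 - χ (p : ZMod m) / (p : ℂ) ^ s)⁻¹

/-! ### Haar measures -/

section Haar

variable (p : ℕ) [Fact p.Prime]

noncomputable instance : MeasurableSpace ℚ_[p] := borel _

instance : BorelSpace ℚ_[p] := ⟨rfl⟩

instance : BorelSpace ℚ_[p]ˣ :=
  ⟨by
    rw [(Units.isEmbedding_val₀ (G₀ := ℚ_[p])).eq_induced, borel_comap]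
    rfl⟩

noncomputable instance : MeasurableSpace (GL (Fin 2) ℤ_[p]) := borel _

instance : BorelSpace (GL (Fin 2) ℤ_[p]) := ⟨rfl⟩

instance : CompactSpace (GL (Fin 2) ℤ_[p]) :=
  have : CompactSpace (Matrix (Fin 2) (Fin 2) ℤ_[p]) :=
    inferInstanceAs (CompactSpace (Fin 2 → Fin 2 → ℤ_[p]))
  inferInstanceAs (CompactSpace (Matrix (Fin 2) (Fin 2) ℤ_[p])ˣ)

/-- The compact open subgroup `ℤ_p` of `ℚ_p`. -/
def zpCompacts : TopologicalSpace.PositiveCompacts ℚ_[p] where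
  carrier := Metric.closedBall 0 1
  isCompact' := isCompact_closedBall 0 1
  interior_nonempty' := ⟨0, mem_interior_iff_mem_nhds.2 (Metric.closedBall_mem_nhds 0 one_pos)⟩

/-- The Haar measure `du` on `ℚ_p` with `vol(ℤ_p) = 1`. -/
noncomputable def haarQp : Measure ℚ_[p] := Measure.addHaarMeasure (zpCompacts p)

/-- The compact open subgroup `ℤ_pˣ` of `ℚ_pˣ`. -/
def zpUnitsCompacts : TopologicalSpace.PositiveCompacts ℚ_[p]ˣ where
  carrier := {t | ‖(t : ℚ_[p])‖ = 1}
  isCompact' := by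
    have h : (Units.val '' {t : ℚ_[p]ˣ | ‖(t : ℚ_[p])‖ = 1}) = Metric.sphere (0 : ℚ_[p]) 1 := by
      ext x
      simp only [Set.mem_image, Set.mem_ofPred_eq, mem_sphere_zero_iff_norm]
      constructor
      · rintro ⟨t, ht, rfl⟩
        exact ht
      · intro hx
        have hx0 : x ≠ 0 := by
          rintro rfl
          simp at hx
        exact ⟨Units.mk0 x hx0, hx, rfl⟩
    rw [(Units.isEmbedding_val₀ (G₀ := ℚ_[p])).isCompact_iff, h]
    exact isCompact_sphere 0 1
  interior_nonempty' := by
    have hopen : IsOpen {t : ℚ_[p]ˣ | ‖(t : ℚ_[p])‖ = 1} := by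
      have h := (IsUltrametricDist.isOpen_sphere (0 : ℚ_[p]) one_ne_zero).preimage
        Units.continuous_val
      convert h using 1
      ext t
      simp
    rw [hopen.interior_eq]
    exact ⟨1, by simp⟩

/-- The Haar measure `dˣt` on `ℚ_pˣ` with `vol(ℤ_pˣ) = 1`. -/
noncomputable def haarQpUnits : Measure ℚ_[p]ˣ := Measure.haarMeasure (zpUnitsCompacts p)

/-- The Haar measure `dg` on `GL₂(ℤ_p)` with total volume `1`. -/
noncomputable def haarGL : Measure (GL (Fin 2) ℤ_[p]) := Measure.haarMeasure ⊤

end Haar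

/-! ### The local factors -/

section Factors

variable (p : ℕ) [Fact p.Prime]

/-- The inclusion `GL₂(ℤ_p) → GL₂(ℚ_p)`. -/
noncomputable def toGLQp (g : GL (Fin 2) ℤ_[p]) : GL (Fin 2) ℚ_[p] :=
  Matrix.GeneralLinearGroup.map PadicInt.Coe.ringHom g

/-- The averaging operator `Φ ↦ (x ↦ ∫ χ̃_p(det g) Φ(g x) dg)` over `GL₂(ℤ_p)`. -/
noncomputable def average {m : ℕ} [NeZero m] (χ : DirichletCharacter ℂ m)
    (Φ : Form ℚ_[p] → ℂ) (x : Form ℚ_[p]) : ℂ :=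
  ∫ g, localChar χ p (Matrix.GeneralLinearGroup.det (toGLQp p g)) * Φ (act (toGLQp p g) x)
    ∂(haarGL p)

open Classical in
/-- The characteristic function `Φ_{p,a}` of `a + p^e V(ℤ_p)` in `V(ℚ_p)`: the integral forms
that reduce to `a` modulo `p^e`. -/
noncomputable def charFun (e : ℕ) (a : Form (ZMod (p ^ e))) (x : Form ℚ_[p]) : ℂ :=
  if ∃ y : Form ℤ_[p], (∀ i, x i = (y i : ℚ_[p])) ∧ ∀ i, PadicInt.toZModPow e (y i) = a i
  then 1 else 0

/-- The integrand in the definition of `B_{p^e}(a)`. -/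
noncomputable def integrandB (e : ℕ) (a : Form (ZMod (p ^ e)))
    (z : ℚ_[p]ˣ × (Fin 2 → ℚ_[p])) : ℂ :=
  ((‖(z.1 : ℚ_[p])‖ ^ 2 : ℝ) : ℂ) *
    average p (1 : DirichletCharacter ℂ 1) (charFun p e a) ![0, z.1, z.2 0, z.2 1]

/-- The measure `dˣt du₁ ⋯ du_n` on `ℚ_pˣ × ℚ_p^n`. -/
noncomputable def prodHaar (n : ℕ) : Measure (ℚ_[p]ˣ × (Fin n → ℚ_[p])) :=
  (haarQpUnits p).prod (Measure.pi fun _ => haarQp p)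

/-- The local factor
`B_{p^e}(a) = p^{4e} (1 - p^{-2}) ∫ |t|² (M_p Φ_{p,a})(0, t, u₃, u₄) dˣt du₃ du₄`. -/
noncomputable def localB (e : ℕ) (a : Form (ZMod (p ^ e))) : ℂ :=
  (p : ℂ) ^ (4 * e) * (1 - ((p : ℂ) ^ 2)⁻¹) * ∫ z, integrandB p e a z ∂(prodHaar p 2)

/-- The integrand in the definition of `C_{p^e}(a, χ)`. -/
noncomputable def integrandC (e : ℕ) (a : Form (ZMod (p ^ e))) {m : ℕ} [NeZero m]
    (χ : DirichletCharacter ℂ m) (z : ℚ_[p]ˣ × (Fin 3 → ℚ_[p])) : ℂ :=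
  localChar χ p z.1 * ((‖(z.1 : ℚ_[p])‖ ^ (1 / 3 : ℝ) : ℝ) : ℂ) *
    average p χ⁻¹ (charFun p e a) ![z.1, z.2 0, z.2 1, z.2 2]

/-- The local factor `C_{p^e}(a, χ) = p^{4e} L_p(1/3, χ⁻¹)⁻¹
∫ χ̃_p(t) |t|^{1/3} (M_{p,χ⁻¹} Φ_{p,a})(t, u₂, u₃, u₄) dˣt du₂ du₃ du₄`. -/
noncomputable def localC (e : ℕ) (a : Form (ZMod (p ^ e))) {m : ℕ} [NeZero m]
    (χ : DirichletCharacter ℂ m) : ℂ :=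
  (p : ℂ) ^ (4 * e) * (localL (1 / 3) χ⁻¹ p)⁻¹ * ∫ z, integrandC p e a χ z ∂(prodHaar p 3)

end Factors

end CubicFormResidue

namespace CubicFormResidue

/-! ### The action on binary cubic forms -/

section Action

variable {R S : Type*} [CommRing R] [CommRing S]

/-! Both integrals reduce to one finite question: over $g\in\mathrm{GL}_2(\mathbb Z/p^e)$, how is
the leading coefficient of $g\cdot a$ distributed?

Since $p\nmid m$, the character $\tilde\chi_p$ is unramified with $t\mapsto\chi(p)^{-v(t)}$
(`localChar_eq`), so the twist by $\det g$ is trivial. The average of $\Phi_{p,a}$ vanishes off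
integral forms. At an integral $x$ it is the proportion of $g$ with $g\bar x=a$, hence also of $g$
with $ga=\bar x$ (`average_coe`, `orbitDensity_eq`). Summing over the free coefficients leaves the
proportion $\lambda(c)$ of $g$ for which $ga$ has leading coefficient $c$. This depends on $c$ only
up to units, so the $\mathcal C$-integral is $p^{-3e}\sum_k\omega^k\lambda(p^k)$ with
$\omega=\chi(p)^2p^{-1/3}$ (`integrable_and_integral_prodHaar`).

The leading coefficient of $ga$ is, up to a unit, the value of $a$ at the first row of $g$, whose
class modulo $p$ is uniform on $\mathbb P^1(\mathbb F_p)$. Let $a\bmod p$ have $N$ simple and $D$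
multiple roots. Away from the roots the value is equidistributed over units (`leadDensity_one`).
Near a simple root Hensel's lemma makes it equidistributed over $p\mathbb Z/p^e$
(`density_isSimpleAt_and`). Near a multiple root maximality keeps it nonzero modulo $p^2$, and it is
equidistributed over $p$ times units (`density_isMultipleAt_and`). So $\lambda(p^k)$ is constant for
$k\ge2$, and the series is two terms plus a geometric tail whose denominator $1-\omega$ is cancelled
by the $L$-factor.

For $\mathcal B$ the leading coefficient is $0$, and maximality forces the next coefficient $t$ to
be a unit. All units contribute equally, so the integral is a multiple of $\lambda(0)$ and $\mathcal
B=N$. The table follows by inserting $(N,D)$ for each type and using $\omega^3=p^{-1}$. -/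

theorem act_mul (g h : GL (Fin 2) R) (x : Form R) : act (g * h) x = act g (act h x) := by
  ext i
  fin_cases i <;>
  · simp only [act, Units.val_mul, Matrix.mul_apply, Fin.sum_univ_two, map_mul, mul_inv_rev,
      Matrix.cons_val, Fin.zero_eta, Fin.mk_one, Fin.reduceFinMk]
    ring

theorem act_one (x : Form R) : act 1 x = x := by
  ext i
  fin_cases i <;> simp [act]

theorem act_inv_eq_iff (g : GL (Fin 2) R) (x y : Form R) : act g⁻¹ x = y ↔ act g y = x := by
  constructor
  · rintro rfl
    rw [← act_mul, mul_inv_cancel, act_one]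
  · rintro rfl
    rw [← act_mul, inv_mul_cancel, act_one]

theorem act_map (f : R →+* S) (g : GL (Fin 2) R) (x : Form R) :
    act (Matrix.GeneralLinearGroup.map f g) (fun i => f (x i)) = fun i => f (act g x i) := by
  have hd : (((Matrix.GeneralLinearGroup.det (Matrix.GeneralLinearGroup.map f g))⁻¹ : Sˣ) : S)
      = f ((Matrix.GeneralLinearGroup.det g)⁻¹ : Rˣ) := by
    rw [Matrix.GeneralLinearGroup.map_det, ← map_inv]
    rfl
  ext i
  have h2 : f 2 = 2 := map_ofNat f 2
  have h3 : f 3 = 3 := map_ofNat f 3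
  fin_cases i <;> simp [act, -Matrix.coe_units_inv, hd, h2, h3,
    Matrix.GeneralLinearGroup.map_apply]

/-- The leading coefficient sees only the first row of `g`, as a point, and a unit factor. This
turns orbit counts into counts of values of the form. -/
theorem act_apply_zero (g : GL (Fin 2) R) (x : Form R) :
    act g x 0 = ((Matrix.GeneralLinearGroup.det g)⁻¹ : Rˣ) * eval x (g.val 0 0) (g.val 0 1) := by
  simp only [act, eval, Matrix.cons_val]
  ring

theorem act_apply_zero_eq_zero_iff (g : GL (Fin 2) R) (x : Form R) :
    act g x 0 = 0 ↔ eval x (g.val 0 0) (g.val 0 1) = 0 := by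
  rw [act_apply_zero, Units.mul_right_eq_zero]

theorem act_apply_one (g : GL (Fin 2) R) (x : Form R) :
    act g x 1 = ((Matrix.GeneralLinearGroup.det g)⁻¹ : Rˣ) *
      (3 * g.val 0 0 ^ 2 * g.val 1 0 * x 0
        + (g.val 0 0 ^ 2 * g.val 1 1 + 2 * g.val 0 0 * g.val 0 1 * g.val 1 0) * x 1
        + (g.val 0 1 ^ 2 * g.val 1 0 + 2 * g.val 0 0 * g.val 0 1 * g.val 1 1) * x 2
        + 3 * g.val 0 1 ^ 2 * g.val 1 1 * x 3) := by
  simp only [act, Matrix.cons_val]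

theorem det_eq (g : GL (Fin 2) R) :
    (Matrix.GeneralLinearGroup.det g : R) = g.val 0 0 * g.val 1 1 - g.val 0 1 * g.val 1 0 := by
  simp [Matrix.det_fin_two]

/-- The diagonal matrix with entries `a` and `d`. -/
def diagGL (a d : Rˣ) : GL (Fin 2) R where
  val := !![(a : R), 0; 0, (d : R)]
  inv := !![((a⁻¹ : Rˣ) : R), 0; 0, ((d⁻¹ : Rˣ) : R)]
  val_inv := by simp [Matrix.one_fin_two]
  inv_val := by simp [Matrix.one_fin_two]

theorem act_diagGL (a d : Rˣ) (x : Form R) :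
    act (diagGL a d) x = ![(d⁻¹ : Rˣ) * a ^ 2 * x 0, a * x 1, d * x 2,
      (a⁻¹ : Rˣ) * d ^ 2 * x 3] := by
  have ha : ((a⁻¹ : Rˣ) : R) * a = 1 := by simp
  have hd : ((d⁻¹ : Rˣ) : R) * d = 1 := by simp
  ext i
  fin_cases i
  · simp [act, diagGL]
    linear_combination (((d⁻¹ : Rˣ) : R) * a ^ 2 * x 0) * ha
  · simp [act, diagGL]
    linear_combination (((d⁻¹ : Rˣ) : R) * d * a * x 1) * ha + a * x 1 * hd
  · simp [act, diagGL]
    linear_combination (((a⁻¹ : Rˣ) : R) * a * d * x 2) * hd + d * x 2 * ha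
  · simp [act, diagGL]
    linear_combination (((a⁻¹ : Rˣ) : R) * d ^ 2 * x 3) * hd

/-- The upper unipotent matrix with off-diagonal entry `s`. -/
def upperGL (s : R) : GL (Fin 2) R where
  val := !![1, s; 0, 1]
  inv := !![1, -s; 0, 1]
  val_inv := by simp [Matrix.one_fin_two]
  inv_val := by simp [Matrix.one_fin_two]

theorem act_upperGL (s : R) (x : Form R) :
    act (upperGL s) x = ![x 0 + s * x 1 + s ^ 2 * x 2 + s ^ 3 * x 3,
      x 1 + 2 * s * x 2 + 3 * s ^ 2 * x 3, x 2 + 3 * s * x 3, x 3] := by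
  ext i
  fin_cases i <;> simp [act, upperGL]

/-- Any entrywise lift of an invertible matrix works, because a local homomorphism reflects
invertibility of the determinant. -/
theorem map_surjective_of_isLocalHom (f : R →+* S) [IsLocalHom f] (hf : Function.Surjective f) :
    Function.Surjective (Matrix.GeneralLinearGroup.map (n := Fin 2) f) := by
  intro g
  choose s hs using hf
  let M : Matrix (Fin 2) (Fin 2) R := Matrix.of fun i j => s (g.val i j)
  have hM : f.mapMatrix M = g.val := by
    ext i j
    simp [M, hs]
  have hu : IsUnit M.det := by
    apply IsUnit.of_map f
    rw [RingHom.map_det, hM]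
    exact (Matrix.isUnit_iff_isUnit_det _).1 g.isUnit
  refine ⟨Matrix.GeneralLinearGroup.mk'' M hu, ?_⟩
  ext i j
  exact hs _

end Action

/-! ### Densities in finite groups -/

section Density

/-- The proportion of the elements of a finite type that satisfy `P`. -/
noncomputable def density {G : Type*} (P : G → Prop) : ℂ :=
  (Nat.card {g // P g} : ℂ) / Nat.card G

theorem density_congr {G : Type*} {P Q : G → Prop} (h : ∀ g, P g ↔ Q g) :
    density P = density Q := by
  rw [show P = Q from funext fun g => propext (h g)]

theorem density_false {G : Type*} {P : G → Prop} (h : ∀ g, ¬ P g) : density P = 0 := by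
  have : IsEmpty {g // P g} := ⟨fun g => h g g.2⟩
  simp [density]

theorem density_true {G : Type*} [Finite G] [Nonempty G] {P : G → Prop} (h : ∀ g, P g) :
    density P = 1 := by
  rw [density, Nat.card_congr (Equiv.subtypeUnivEquiv h), div_self]
  exact_mod_cast Nat.card_pos.ne'

theorem density_equiv {G H : Type*} (f : G ≃ H) (P : H → Prop) :
    density (fun g => P (f g)) = density P := by
  rw [density, density, Nat.card_congr f, Nat.card_congr (f.subtypeEquiv fun _ => Iff.rfl)]

theorem density_mul_right {G : Type*} [Group G] (P : G → Prop) (h : G) :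
    density (fun g => P (g * h)) = density P :=
  density_equiv (Equiv.mulRight h) P

theorem density_mul_left {G : Type*} [Group G] (P : G → Prop) (h : G) :
    density (fun g => P (h * g)) = density P :=
  density_equiv (Equiv.mulLeft h) P

theorem density_inv {G : Type*} [Group G] (P : G → Prop) :
    density (fun g => P g⁻¹) = density P :=
  density_equiv (Equiv.inv G) P

/-- Densities add up over a partition. -/
theorem sum_density {G ι : Type*} [Finite G] [Fintype ι] (P : G → Prop) (F : ι → G → Prop)
    (h : ∀ g, P g → ∃! i, F i g) : ∑ i, density (fun g => P g ∧ F i g) = density P := by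
  classical
  have : Fintype G := Fintype.ofFinite G
  simp only [density]
  rw [← Finset.sum_div]
  congr 1
  have hc : ∀ Q : G → Prop, (Nat.card {g // Q g} : ℂ) = ∑ g, if Q g then 1 else 0 := fun Q => by
    rw [Nat.card_eq_fintype_card, Fintype.card_subtype, Finset.sum_boole]
  simp only [hc]
  rw [Finset.sum_comm]
  refine Finset.sum_congr rfl fun g _ => ?_
  by_cases hg : P g
  · obtain ⟨i, hi, hu⟩ := h g hg
    rw [Finset.sum_eq_single i]
    · simp [hg, hi]
    · intro j _ hj
      simp only [hg, true_and, ite_eq_right_iff]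
      exact fun hF => absurd (hu j hF) hj
    · simp
  · simp [hg]

theorem density_and_add_density_and_not {G : Type*} [Finite G] (P Q : G → Prop) :
    density (fun g => P g ∧ Q g) + density (fun g => P g ∧ ¬ Q g) = density P := by
  rw [← sum_density P (fun (b : Bool) g => Q g ↔ b = true)]
  · simp
  · intro g _
    by_cases h : Q g
    · exact ⟨true, by simp [h], by simp [h]⟩
    · exact ⟨false, by simp [h], by simp [h]⟩

/-- Fibres are translates of one another, so they have equal densities, and these sum to $1$. -/
theorem density_fiber {G H : Type*} [Group G] [Group H] [Finite G] [Finite H]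
    (f : G →* H) (hf : Function.Surjective f) (h : H) :
    density (fun g => f g = h) = (Nat.card H : ℂ)⁻¹ := by
  have : Fintype H := Fintype.ofFinite H
  have key : ∀ k : H, density (fun g => f g = k) = density (fun g => f g = h) := fun k => by
    obtain ⟨x, hx⟩ := hf (h * k⁻¹)
    rw [← density_mul_left (fun g => f g = h) x]
    refine density_congr fun g => ?_
    rw [map_mul, hx, mul_assoc, mul_eq_left, inv_mul_eq_one, eq_comm]
  have hs := sum_density (fun _ : G => True) (fun k g => f g = k) (fun g _ => ⟨f g, rfl, by simp⟩)
  simp only [true_and, key, Finset.sum_const, Finset.card_univ, nsmul_eq_mul] at hs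
  rw [density_true (fun _ => trivial), ← Nat.card_eq_fintype_card] at hs
  exact eq_inv_of_mul_eq_one_right hs

/-- Lets a condition that depends only on the reduction modulo $p$ be measured in
$\mathrm{GL}_2(\mathbb F_p)$. -/
theorem density_map {G H : Type*} [Group G] [Group H] [Finite G] [Finite H]
    (f : G →* H) (hf : Function.Surjective f) (P : H → Prop) :
    density (fun g => P (f g)) = density P := by
  classical
  have : Fintype H := Fintype.ofFinite H
  have e : ∀ h, density (fun g => P (f g) ∧ f g = h) =
      density (fun k => P k ∧ k = h) := fun h => by
    by_cases hP : P h
    · rw [density_congr (Q := fun g => f g = h), density_congr (Q := fun k => MonoidHom.id H k = h),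
        density_fiber f hf, density_fiber _ Function.surjective_id]
      · intro k
        exact ⟨fun h => h.2, fun h' => ⟨by rw [show k = h from h']; exact hP, h'⟩⟩
      · intro g
        exact ⟨fun h => h.2, fun h' => ⟨by rw [h']; exact hP, h'⟩⟩
    · rw [density_false, density_false]
      · rintro k ⟨h1, rfl⟩
        exact hP h1
      · rintro k ⟨h1, rfl⟩
        exact hP h1
  rw [← sum_density (fun g => P (f g)) (fun h g => f g = h) (fun g _ => ⟨f g, rfl, by simp⟩),
    ← sum_density P (fun h g => g = h) (fun g _ => ⟨g, rfl, by simp⟩)]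
  exact Finset.sum_congr rfl fun h _ => e h

end Density

/-! ### Roots of forms over a finite field -/

section FiniteField

variable {K : Type*} [Field K]

theorem row_ne_zero (g : GL (Fin 2) K) : g.val 0 ≠ 0 := by
  intro h
  have h0 := congrFun h 0
  have h1 := congrFun h 1
  have := det_eq g
  simp only [Pi.zero_apply] at h0 h1
  rw [h0, h1] at this
  simp at this
  exact (Matrix.GeneralLinearGroup.det g).ne_zero (by simpa using this)

/-- The point of the projective line given by the first row. -/
noncomputable def rowPoint (g : GL (Fin 2) K) : ℙ K (Fin 2 → K) :=
  Projectivization.mk K (g.val 0) (row_ne_zero g)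

/-- The stabiliser of $(1:0)$ under the right action on rows is the lower triangular group. -/
theorem rowPoint_eq_iff (g h : GL (Fin 2) K) :
    rowPoint g = rowPoint h ↔ (g * h⁻¹).val 0 1 = 0 := by
  have hrow : ∀ k : GL (Fin 2) K, ∀ j, (k * h).val 0 j =
      k.val 0 0 * h.val 0 j + k.val 0 1 * h.val 1 j := fun k j => by
    simp [Matrix.mul_apply, Fin.sum_univ_two]
  rw [rowPoint, rowPoint, Projectivization.mk_eq_mk_iff']
  have hg : g = (g * h⁻¹) * h := by group
  generalize g * h⁻¹ = k at hg
  subst hg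
  constructor
  · rintro ⟨c, hc⟩
    have h0 := congrFun hc 0
    have h1 := congrFun hc 1
    simp only [Pi.smul_apply, smul_eq_mul, hrow] at h0 h1
    have hd := det_eq h
    have hd' := (Matrix.GeneralLinearGroup.det h).ne_zero
    apply (mul_eq_zero.1
      (?_ : k.val 0 1 * (Matrix.GeneralLinearGroup.det h : K) = 0)).resolve_right hd'
    rw [hd]
    linear_combination h.val 0 1 * h0 - h.val 0 0 * h1
  · intro h0
    refine ⟨k.val 0 0, ?_⟩
    ext j
    simp [hrow, h0]

theorem exists_rowPoint_eq (P : ℙ K (Fin 2 → K)) : ∃ g, rowPoint g = P := by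
  induction P using Projectivization.ind with
  | h v hv =>
  by_cases h0 : v 0 = 0
  · have h1 : v 1 ≠ 0 := fun h1 => hv (by ext i; fin_cases i <;> simp [h0, h1])
    let M : Matrix (Fin 2) (Fin 2) K := !![v 0, v 1; 1, 0]
    refine ⟨Matrix.GeneralLinearGroup.mkOfDetNeZero M (by simp [M, Matrix.det_fin_two, h1]), ?_⟩
    rw [rowPoint, Projectivization.mk_eq_mk_iff']
    refine ⟨1, ?_⟩
    ext i
    fin_cases i <;> simp [Matrix.GeneralLinearGroup.mkOfDetNeZero, M]
  · let M : Matrix (Fin 2) (Fin 2) K := !![v 0, v 1; 0, 1]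
    refine ⟨Matrix.GeneralLinearGroup.mkOfDetNeZero M (by simp [M, Matrix.det_fin_two, h0]), ?_⟩
    rw [rowPoint, Projectivization.mk_eq_mk_iff']
    refine ⟨1, ?_⟩
    ext i
    fin_cases i <;> simp [Matrix.GeneralLinearGroup.mkOfDetNeZero, M]

theorem rowPoint_mem_projRoots_iff (a : Form K) (g : GL (Fin 2) K) :
    rowPoint g ∈ projRoots a ↔ act g a 0 = 0 := by
  obtain ⟨c, hc⟩ := Projectivization.exists_smul_eq_mk_rep K (g.val 0) (row_ne_zero g)
  have h0 := congrFun hc 0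
  have h1 := congrFun hc 1
  simp only [Pi.smul_apply, Units.smul_def, smul_eq_mul] at h0 h1
  rw [act_apply_zero_eq_zero_iff, projRoots, Set.mem_ofPred_eq, rowPoint, ← h0, ← h1]
  have : eval a (c * g.val 0 0) (c * g.val 0 1) =
      (c ^ 3 : Kˣ) * eval a (g.val 0 0) (g.val 0 1) := by
    simp only [eval, Units.val_pow_eq_pow_val]
    ring
  rw [this, Units.mul_right_eq_zero]

variable [Finite K]

/-- Right translation carries any point to any other, so the $\#K+1$ points of the line are equally
likely. -/
theorem density_rowPoint_eq (P : ℙ K (Fin 2 → K)) :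
    density (fun g : GL (Fin 2) K => rowPoint g = P) = ((Nat.card K : ℂ) + 1)⁻¹ := by
  have : Fintype (ℙ K (Fin 2 → K)) := Fintype.ofFinite _
  have key : ∀ Q, density (fun g : GL (Fin 2) K => rowPoint g = Q) =
      density (fun g : GL (Fin 2) K => g.val 0 1 = 0) := fun Q => by
    obtain ⟨h, rfl⟩ := exists_rowPoint_eq Q
    simp only [rowPoint_eq_iff]
    exact density_mul_right (fun g : GL (Fin 2) K => g.val 0 1 = 0) h⁻¹
  have hs := sum_density (fun _ : GL (Fin 2) K => True) (fun k g => rowPoint g = k)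
    (fun g _ => ⟨rowPoint g, rfl, by simp⟩)
  simp only [true_and, key, Finset.sum_const, Finset.card_univ, nsmul_eq_mul] at hs
  rw [density_true (fun _ => trivial), ← Nat.card_eq_fintype_card,
    Projectivization.card_of_finrank_two K _ (by simp)] at hs
  rw [key]
  exact eq_inv_of_mul_eq_one_right (by exact_mod_cast hs)

theorem density_act_zero_eq_zero (a : Form K) :
    density (fun g : GL (Fin 2) K => act g a 0 = 0) =
      (projRoots a).ncard * ((Nat.card K : ℂ) + 1)⁻¹ := by
  classical
  have : Fintype (ℙ K (Fin 2 → K)) := Fintype.ofFinite _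
  simp only [← rowPoint_mem_projRoots_iff]
  rw [← sum_density _ (fun k g => rowPoint g = k) (fun g _ => ⟨rowPoint g, rfl, by simp⟩)]
  have : ∀ P, density (fun g : GL (Fin 2) K => rowPoint g ∈ projRoots a ∧ rowPoint g = P) =
      if P ∈ projRoots a then ((Nat.card K : ℂ) + 1)⁻¹ else 0 := fun P => by
    split_ifs with hP
    · rw [← density_rowPoint_eq P]
      refine density_congr fun g => ⟨fun h => h.2, ?_⟩
      rintro rfl
      exact ⟨hP, rfl⟩
    · refine density_false ?_
      rintro g ⟨h, rfl⟩
      exact hP h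
  simp only [this]
  rw [← Finset.sum_filter, Finset.sum_const, nsmul_eq_mul, Set.ncard_eq_toFinset_card']
  congr 3
  ext
  simp

end FiniteField

/-! ### Simple and multiple roots for the five types -/

section RootDensities

variable {K : Type*} [Field K]

theorem vec_neg_ne_zero {r s : K} (h : r ≠ 0 ∨ s ≠ 0) : (![-s, r] : Fin 2 → K) ≠ 0 := by
  intro h0
  have h1 : -s = 0 := congrFun h0 0
  have h2 : r = 0 := congrFun h0 1
  rcases h with h | h
  · exact h h2
  · exact h (neg_eq_zero.1 h1)

theorem linear_eq_zero_iff {r s : K} (h : r ≠ 0 ∨ s ≠ 0) (g : GL (Fin 2) K) :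
    r * g.val 0 0 + s * g.val 0 1 = 0 ↔
      rowPoint g = Projectivization.mk K ![-s, r] (vec_neg_ne_zero h) := by
  rw [rowPoint, Projectivization.mk_eq_mk_iff']
  constructor
  · intro h0
    by_cases hr : r = 0
    · have hs : s ≠ 0 := h.resolve_left (not_not.2 hr)
      have h1 : g.val 0 1 = 0 := by simpa [hr, hs] using h0
      refine ⟨-(g.val 0 0 / s), ?_⟩
      ext i
      fin_cases i
      · simp [hs]
      · simp [hr, h1]
    · refine ⟨g.val 0 1 / r, ?_⟩
      ext i
      fin_cases i
      · simp
        field_simp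
        linear_combination -h0
      · simp [hr]
  · rintro ⟨c, hc⟩
    have h0 : c * -s = g.val 0 0 := congrFun hc 0
    have h1 : c * r = g.val 0 1 := congrFun hc 1
    rw [← h0, ← h1]
    ring

/-- The proportion of the projective line made up of simple roots is `N / (#K + 1)`, that made up
of multiple roots is `D / (#K + 1)`. -/
def HasRootDensities (a : Form K) (N D : ℂ) : Prop :=
  density (fun g : GL (Fin 2) K => act g a 0 = 0 ∧ act g a 1 ≠ 0) =
      N * ((Nat.card K : ℂ) + 1)⁻¹ ∧
    density (fun g : GL (Fin 2) K => act g a 0 = 0 ∧ act g a 1 = 0) =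
      D * ((Nat.card K : ℂ) + 1)⁻¹

theorem HasRootDensities.act_iff (a : Form K) (N D : ℂ) (h : GL (Fin 2) K) :
    HasRootDensities (act h a) N D ↔ HasRootDensities a N D := by
  simp only [HasRootDensities, ← act_mul]
  rw [density_mul_right (fun g : GL (Fin 2) K => act g a 0 = 0 ∧ act g a 1 ≠ 0) h,
    density_mul_right (fun g : GL (Fin 2) K => act g a 0 = 0 ∧ act g a 1 = 0) h]

theorem IsType3.act_ne_zero {a : Form K} (ha : IsType3 a) (g : GL (Fin 2) K) : act g a 0 ≠ 0 := by
  rw [Ne, ← rowPoint_mem_projRoots_iff, show projRoots a = ∅ from ha]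
  exact id

theorem det_ne_zero (g : GL (Fin 2) K) :
    g.val 0 0 * g.val 1 1 - g.val 0 1 * g.val 1 0 ≠ 0 := by
  rw [← det_eq]
  exact (Matrix.GeneralLinearGroup.det g).ne_zero

/-- The irreducible quadratic factor is nonzero on the first row. If the linear factor vanishes
there, the second coefficient is, up to $\det^{-1}$, that quadratic value times the linear factor on
the second row. The latter is nonzero, since a nonzero linear form cannot vanish on both rows of an
invertible matrix. -/
theorem linear_mul_quadratic_act {r s k l n : K} (hL : r ≠ 0 ∨ s ≠ 0)
    (hQ : ∀ u v : K, k * u ^ 2 + l * u * v + n * v ^ 2 = 0 → u = 0 ∧ v = 0) (g : GL (Fin 2) K) :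
    (act g ![r * k, r * l + s * k, r * n + s * l, s * n] 0 = 0 ↔
      r * g.val 0 0 + s * g.val 0 1 = 0) ∧
    (act g ![r * k, r * l + s * k, r * n + s * l, s * n] 0 = 0 →
      act g ![r * k, r * l + s * k, r * n + s * l, s * n] 1 ≠ 0) := by
  have hdet := det_ne_zero g
  have hq : k * g.val 0 0 ^ 2 + l * g.val 0 0 * g.val 0 1 + n * g.val 0 1 ^ 2 ≠ 0 := fun h => by
    obtain ⟨h0, h1⟩ := hQ _ _ h
    rw [h0, h1] at hdet
    simp at hdet
  have hiff : act g ![r * k, r * l + s * k, r * n + s * l, s * n] 0 = 0 ↔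
      r * g.val 0 0 + s * g.val 0 1 = 0 := by
    rw [act_apply_zero_eq_zero_iff, show eval ![r * k, r * l + s * k, r * n + s * l, s * n]
      (g.val 0 0) (g.val 0 1) = (r * g.val 0 0 + s * g.val 0 1) *
        (k * g.val 0 0 ^ 2 + l * g.val 0 0 * g.val 0 1 + n * g.val 0 1 ^ 2) by
      simp only [eval, Matrix.cons_val]; ring, mul_eq_zero, or_iff_left hq]
  refine ⟨hiff, fun h => ?_⟩
  have h0 := hiff.1 h
  have h1 : r * g.val 1 0 + s * g.val 1 1 ≠ 0 := fun h1 => by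
    rcases hL with hr | hs
    · apply mul_ne_zero hr hdet
      linear_combination g.val 1 1 * h0 - g.val 0 1 * h1
    · apply mul_ne_zero hs hdet
      linear_combination g.val 0 0 * h1 - g.val 1 0 * h0
  rw [act_apply_one, Ne, Units.mul_right_eq_zero]
  intro h2
  apply mul_ne_zero h1 hq
  simp only [Matrix.cons_val] at h2
  linear_combination h2 - (2 * k * g.val 0 0 * g.val 1 0 + l * (g.val 0 0 * g.val 1 1 +
    g.val 0 1 * g.val 1 0) + 2 * n * g.val 0 1 * g.val 1 1) * h0

theorem IsType21.act_one_ne_zero {a : Form K} (ha : IsType21 a) (g : GL (Fin 2) K)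
    (h : act g a 0 = 0) : act g a 1 ≠ 0 := by
  obtain ⟨r, s, k, l, n, hL, hQ, rfl⟩ := ha
  exact (linear_mul_quadratic_act hL hQ g).2 h

/-- The form $tu^2v$ has its double root at $(0:1)$ and its simple root at $(1:0)$. -/
theorem act_square_mul {t : K} (ht : t ≠ 0) (g : GL (Fin 2) K) :
    (act g ![0, t, 0, 0] 0 = 0 ∧ act g ![0, t, 0, 0] 1 = 0 ↔ g.val 0 0 = 0) ∧
    (act g ![0, t, 0, 0] 0 = 0 ∧ act g ![0, t, 0, 0] 1 ≠ 0 ↔ g.val 0 1 = 0) := by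
  have hdet := det_ne_zero g
  simp only [act_apply_zero_eq_zero_iff, act_apply_one, Units.mul_right_eq_zero, eval,
    Matrix.cons_val, Ne]
  by_cases h0 : g.val 0 0 = 0
  · have h1 : g.val 0 1 ≠ 0 := fun h1 => by simp [h0, h1] at hdet
    simp [h0, h1]
  · by_cases h1 : g.val 0 1 = 0
    · have h2 : g.val 1 1 ≠ 0 := fun h2 => by simp [h1, h2] at hdet
      simp [h0, h1, h2, ht]
    · simp [h0, h1, ht]

theorem act_cube {t : K} (ht : t ≠ 0) (g : GL (Fin 2) K) :
    (act g ![t, 0, 0, 0] 0 = 0 ↔ g.val 0 0 = 0) ∧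
    (act g ![t, 0, 0, 0] 0 = 0 → act g ![t, 0, 0, 0] 1 = 0) := by
  have h : act g ![t, 0, 0, 0] 0 = 0 ↔ g.val 0 0 = 0 := by
    rw [act_apply_zero_eq_zero_iff]
    simp [eval, ht]
  refine ⟨h, fun h0 => ?_⟩
  rw [act_apply_one, h.1 h0]
  simp

theorem hasRootDensities_of_simple {a : Form K} {N : ℂ}
    (ha : ∀ g, act g a 0 = 0 → act g a 1 ≠ 0)
    (hN : density (fun g : GL (Fin 2) K => act g a 0 = 0) = N * ((Nat.card K : ℂ) + 1)⁻¹) :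
    HasRootDensities a N 0 := by
  constructor
  · rw [← hN]
    exact density_congr fun g => ⟨fun h => h.1, fun h => ⟨h, ha g h⟩⟩
  · rw [density_false fun g h => ha g h.1 h.2, zero_mul]

theorem IsType3.hasRootDensities {a : Form K} (ha : IsType3 a) : HasRootDensities a 0 0 :=
  hasRootDensities_of_simple (fun g h => absurd h (ha.act_ne_zero g))
    (by rw [density_false ha.act_ne_zero, zero_mul])

variable [Finite K]

theorem density_linear_eq_zero {r s : K} (h : r ≠ 0 ∨ s ≠ 0) :
    density (fun g : GL (Fin 2) K => r * g.val 0 0 + s * g.val 0 1 = 0) =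
      ((Nat.card K : ℂ) + 1)⁻¹ := by
  simp only [linear_eq_zero_iff h, density_rowPoint_eq]

theorem IsType21.hasRootDensities {a : Form K} (ha : IsType21 a) : HasRootDensities a 1 0 := by
  refine hasRootDensities_of_simple ha.act_one_ne_zero ?_
  obtain ⟨r, s, k, l, n, hL, hQ, rfl⟩ := ha
  rw [one_mul, ← density_linear_eq_zero hL]
  exact density_congr fun g => (linear_mul_quadratic_act hL hQ g).1

/-- The number of roots is read off from the density of vanishing leading coefficient, which is
invariant under right translation. -/
theorem ncard_projRoots_act (a : Form K) (g : GL (Fin 2) K) :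
    (projRoots (act g a)).ncard = (projRoots a).ncard := by
  have h := density_mul_right (fun h : GL (Fin 2) K => act h a 0 = 0) g
  simp only [act_mul] at h
  rw [density_act_zero_eq_zero, density_act_zero_eq_zero] at h
  exact_mod_cast mul_right_cancel₀ (inv_ne_zero (Nat.cast_add_one_ne_zero _)) h

/-- Move the root to $(1:0)$. Were it multiple, the form would be $v^2(b_2u+b_3v)$, which has at
most two roots. -/
theorem IsType111.act_one_ne_zero {a : Form K} (ha : IsType111 a) (g : GL (Fin 2) K)
    (h0 : act g a 0 = 0) : act g a 1 ≠ 0 := by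
  intro h1
  have hb : act g a ≠ 0 := fun h => ha.1 (by
    rw [← (act_inv_eq_iff g 0 a).2 h]
    ext i
    fin_cases i <;> simp [act])
  have hcard := ncard_projRoots_act a g
  rw [ha.2] at hcard
  generalize act g a = b at *
  have hL : b 2 ≠ 0 ∨ b 3 ≠ 0 := by
    by_contra! h
    exact hb (by ext i; fin_cases i <;> simp [h0, h1, h])
  have hL' : (0 : K) ≠ 0 ∨ (1 : K) ≠ 0 := by simp
  have hsub : projRoots b ⊆ {Projectivization.mk K _ (vec_neg_ne_zero hL),
      Projectivization.mk K _ (vec_neg_ne_zero hL')} := by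
    intro P hP
    obtain ⟨k, rfl⟩ := exists_rowPoint_eq P
    rw [rowPoint_mem_projRoots_iff, act_apply_zero_eq_zero_iff] at hP
    rw [Set.mem_insert_iff, Set.mem_singleton_iff, ← linear_eq_zero_iff hL,
      ← linear_eq_zero_iff hL']
    have : (b 2 * k.val 0 0 + b 3 * k.val 0 1) * k.val 0 1 ^ 2 = 0 := by
      simp only [eval, h0, h1] at hP
      linear_combination hP
    rcases mul_eq_zero.1 this with h | h
    · exact Or.inl h
    · right
      simpa using h
  have := Set.ncard_le_ncard hsub
  have := Set.ncard_insert_le (Projectivization.mk K _ (vec_neg_ne_zero hL))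
    {Projectivization.mk K _ (vec_neg_ne_zero hL')}
  rw [Set.ncard_singleton] at this
  omega

theorem IsType111.hasRootDensities {a : Form K} (ha : IsType111 a) : HasRootDensities a 3 0 :=
  hasRootDensities_of_simple ha.act_one_ne_zero
    (by rw [density_act_zero_eq_zero, ha.2, Nat.cast_ofNat])

theorem density_upperLeft_eq_zero :
    density (fun g : GL (Fin 2) K => g.val 0 0 = 0) = ((Nat.card K : ℂ) + 1)⁻¹ := by
  rw [← density_linear_eq_zero (K := K) (r := 1) (s := 0) (by simp)]
  simp

theorem density_upperRight_eq_zero :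
    density (fun g : GL (Fin 2) K => g.val 0 1 = 0) = ((Nat.card K : ℂ) + 1)⁻¹ := by
  rw [← density_linear_eq_zero (K := K) (r := 0) (s := 1) (by simp)]
  simp

theorem hasRootDensities_square_mul {t : K} (ht : t ≠ 0) :
    HasRootDensities ![0, t, 0, 0] 1 1 := by
  constructor
  · rw [density_congr fun g => (act_square_mul ht g).2, density_upperRight_eq_zero, one_mul]
  · rw [density_congr fun g => (act_square_mul ht g).1, density_upperLeft_eq_zero, one_mul]

theorem hasRootDensities_cube {t : K} (ht : t ≠ 0) :
    HasRootDensities ![t, 0, 0, 0] 0 1 := by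
  constructor
  · rw [density_false fun g h => h.2 ((act_cube ht g).2 h.1), zero_mul]
  · rw [one_mul, ← density_upperLeft_eq_zero]
    exact density_congr fun g =>
      ⟨fun h => (act_cube ht g).1.1 h.1, fun h => ⟨(act_cube ht g).1.2 h,
        (act_cube ht g).2 ((act_cube ht g).1.2 h)⟩⟩

end RootDensities

/-! ### Forms over `ℤ / p ^ e` -/

section Level

theorem castHom_eq_zero_iff {M N : ℕ} [NeZero M] (h : N ∣ M) (x : ZMod M) :
    ZMod.castHom h (ZMod N) x = 0 ↔ (N : ZMod M) ∣ x := by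
  constructor
  · intro hx
    rw [← ZMod.natCast_zmod_val x, map_natCast, ZMod.natCast_eq_zero_iff] at hx
    obtain ⟨k, hk⟩ := hx
    exact ⟨k, by rw [← ZMod.natCast_zmod_val x, hk, Nat.cast_mul]⟩
  · rintro ⟨y, rfl⟩
    rw [map_mul, map_natCast, ZMod.natCast_self, zero_mul]

theorem card_castHom_eq_zero {M N : ℕ} [NeZero M] [NeZero N] (h : N ∣ M) :
    (Nat.card {x : ZMod M // ZMod.castHom h (ZMod N) x = 0} : ℂ) = M / N := by
  let f : ZMod M →+ ZMod N := (ZMod.castHom h (ZMod N)).toAddMonoidHom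
  have hs : Function.Surjective f := ZMod.castHom_surjective h
  have h1 := f.ker.card_mul_index
  rw [AddSubgroup.index_ker, AddMonoidHom.range_eq_top.2 hs] at h1
  simp only [Nat.card_zmod, AddSubgroup.card_top] at h1
  have h2 : Nat.card {x : ZMod M // ZMod.castHom h (ZMod N) x = 0} = Nat.card f.ker := rfl
  rw [h2, eq_div_iff (Nat.cast_ne_zero.2 (NeZero.ne N))]
  exact_mod_cast h1

theorem pMulUnits_subset {p : ℕ} : pMulUnits p ⊆ pMul p := fun _ ⟨y, _, hy⟩ => ⟨y, hy⟩

variable {p e : ℕ} [hp : Fact p.Prime]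

theorem isUnit_iff_castHom_ne_zero (h : p ∣ p ^ e) (x : ZMod (p ^ e)) :
    IsUnit x ↔ ZMod.castHom h (ZMod p) x ≠ 0 := by
  have he : 0 < e := Nat.pos_of_ne_zero fun h0 => hp.out.one_lt.ne' (by simpa [h0] using h)
  rw [← ZMod.natCast_zmod_val x, map_natCast, Ne, ZMod.natCast_eq_zero_iff,
    ZMod.isUnit_iff_coprime, Nat.coprime_pow_right_iff he, Nat.coprime_comm,
    hp.out.coprime_iff_not_dvd]

theorem isLocalHom_castHom (h : p ∣ p ^ e) : IsLocalHom (ZMod.castHom h (ZMod p)) :=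
  ⟨fun x hx => (isUnit_iff_castHom_ne_zero h x).2 hx.ne_zero⟩

/-- At a multiple root modulo `p`, the value of the form is nonzero modulo `p ^ 2`. -/
def IsRegular (h1 : p ∣ p ^ e) (h2 : p ^ 2 ∣ p ^ e) (a : Form (ZMod (p ^ e))) : Prop :=
  ∀ g : GL (Fin 2) (ZMod (p ^ e)), ZMod.castHom h1 (ZMod p) (act g a 0) = 0 →
    ZMod.castHom h1 (ZMod p) (act g a 1) = 0 → ZMod.castHom h2 (ZMod (p ^ 2)) (act g a 0) ≠ 0

theorem act_reduce {M N : ℕ} (h : N ∣ M) (g : GL (Fin 2) (ZMod M)) (a : Form (ZMod M)) (i : Fin 4) :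
    act (Matrix.GeneralLinearGroup.map (ZMod.castHom h (ZMod N)) g) (reduce h a) i =
      ZMod.castHom h (ZMod N) (act g a i) :=
  congrFun (act_map (ZMod.castHom h (ZMod N)) g a) i

theorem isRegular_of_simple (h1 : p ∣ p ^ e) (h2 : p ^ 2 ∣ p ^ e) {a : Form (ZMod (p ^ e))}
    (ha : ∀ g, act g (reduce h1 a) 0 = 0 → act g (reduce h1 a) 1 ≠ 0) : IsRegular h1 h2 a := by
  intro g hg0 hg1
  rw [← act_reduce] at hg0 hg1
  exact absurd hg1 (ha _ hg0)

theorem castHom_castHom {M N L : ℕ} (h : N ∣ M) (h' : L ∣ N) (x : ZMod M) :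
    ZMod.castHom h' (ZMod L) (ZMod.castHom h (ZMod N) x) =
      ZMod.castHom (h'.trans h) (ZMod L) x := by
  rw [← RingHom.comp_apply]
  congr 1
  exact Subsingleton.elim _ _

/-- At a point $(p\alpha,\beta)$ every term except $b_3\beta^3$ is divisible by $p^2$. Here $\beta$
is a unit because the determinant is, and $b_3$ is $p$ times a unit. -/
theorem act_zero_ne_zero_of_sq {h : p ∣ p ^ 2} {b : Form (ZMod (p ^ 2))} (hb2 : b 2 ∈ pMul p)
    (hb3 : b 3 ∈ pMulUnits p) (g : GL (Fin 2) (ZMod (p ^ 2)))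
    (hg : ZMod.castHom h (ZMod p) (g.val 0 0) = 0) : act g b 0 ≠ 0 := by
  obtain ⟨y, hy⟩ := hb2
  obtain ⟨w, hw, hw'⟩ := hb3
  obtain ⟨α, hα⟩ := (castHom_eq_zero_iff h _).1 hg
  have hp2 : (p : ZMod (p ^ 2)) ^ 2 = 0 := by
    rw [← Nat.cast_pow, ZMod.natCast_self]
  have hpne : (p : ZMod (p ^ 2)) ≠ 0 := by
    rw [Ne, ZMod.natCast_eq_zero_iff]
    exact fun hd => absurd (Nat.le_of_dvd hp.out.pos hd) (by nlinarith [hp.out.one_lt])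
  have hβ : IsUnit (g.val 0 1) := by
    rw [isUnit_iff_castHom_ne_zero h]
    intro hβ
    have hd := (isUnit_iff_castHom_ne_zero h _).1 (Matrix.GeneralLinearGroup.det g).isUnit
    rw [det_eq, map_sub, map_mul, map_mul, hg, hβ] at hd
    simp at hd
  rw [Ne, act_apply_zero_eq_zero_iff, show eval b (g.val 0 0) (g.val 0 1) =
    (g.val 0 1 ^ 3 * w) * p by
      simp only [eval]
      rw [hα, hy, hw']
      linear_combination (p * α ^ 3 * b 0 + α ^ 2 * b 1 * g.val 0 1 + α * g.val 0 1 ^ 2 * y) * hp2]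
  rwa [((hβ.pow 3).mul hw).mul_right_eq_zero]

/-- The hypothesis `hb` says that the normal form `b` has no multiple root modulo $p$ other than
$(0:1)$, the point where its value is under control. -/
theorem isRegular_of_reduce_eq_act (h1 : p ∣ p ^ e) (h2 : p ^ 2 ∣ p ^ e) {a : Form (ZMod (p ^ e))}
    {h : p ∣ p ^ 2} {g : GL (Fin 2) (ZMod (p ^ 2))} {b : Form (ZMod (p ^ 2))}
    (hab : reduce h2 a = act g b) (hb2 : b 2 ∈ pMul p) (hb3 : b 3 ∈ pMulUnits p)
    (hb : ∀ k : GL (Fin 2) (ZMod p), act k (reduce h b) 0 = 0 → act k (reduce h b) 1 = 0 →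
      k.val 0 0 = 0) : IsRegular h1 h2 a := by
  intro k hk0 hk1
  rw [← castHom_castHom h2 h, ← act_reduce, hab, ← act_mul, ← act_reduce] at hk0 hk1
  rw [← act_reduce, hab, ← act_mul]
  exact act_zero_ne_zero_of_sq (h := h) hb2 hb3 _ (hb _ hk0 hk1)

theorem hasRootDensities_of_reduce_eq_act (h1 : p ∣ p ^ e) (h2 : p ^ 2 ∣ p ^ e)
    {a : Form (ZMod (p ^ e))} (h : p ∣ p ^ 2) {g : GL (Fin 2) (ZMod (p ^ 2))}
    {b : Form (ZMod (p ^ 2))} (hab : reduce h2 a = act g b) {N D : ℂ}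
    (hb : HasRootDensities (reduce h b) N D) : HasRootDensities (reduce h1 a) N D := by
  have : reduce h1 a = act (Matrix.GeneralLinearGroup.map (ZMod.castHom h (ZMod p)) g)
      (reduce h b) := by
    ext i
    rw [act_reduce, ← hab]
    exact (castHom_castHom h2 h (a i)).symm
  rwa [this, HasRootDensities.act_iff]

theorem castHom_eq_zero_of_mem_pMul {h : p ∣ p ^ 2} {x : ZMod (p ^ 2)} (hx : x ∈ pMul p) :
    ZMod.castHom h (ZMod p) x = 0 :=
  (castHom_eq_zero_iff h x).2 hx

/-- The number of simple roots modulo `p` of a maximal form. -/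
def MaxType.simpleRoots : MaxType → ℂ
  | .t3 => 0
  | .t21 => 1
  | .t111 => 3
  | .t121max => 1
  | .t13max => 0

/-- The number of multiple roots modulo `p` of a maximal form. -/
def MaxType.multipleRoots : MaxType → ℂ
  | .t3 => 0
  | .t21 => 0
  | .t111 => 0
  | .t121max => 1
  | .t13max => 1

/-- The definitions of the types enter only here; afterwards only regularity and the two root counts
matter. Regularity is vacuous for the first three types, which have no multiple root. -/
theorem HasType.isRegular_and_hasRootDensities (he : 2 ≤ e) (h1 : p ∣ p ^ e) (h2 : p ^ 2 ∣ p ^ e)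
    {a : Form (ZMod (p ^ e))} {σ : MaxType} (ha : HasType he a σ) :
    IsRegular h1 h2 a ∧ HasRootDensities (reduce h1 a) σ.simpleRoots σ.multipleRoots := by
  have h : p ∣ p ^ 2 := dvd_pow_self p two_ne_zero
  cases σ with
  | t3 =>
    have ha' : IsType3 (reduce h1 a) := ha
    exact ⟨isRegular_of_simple h1 h2 fun g h0 => absurd h0 (ha'.act_ne_zero g),
      ha'.hasRootDensities⟩
  | t21 =>
    have ha' : IsType21 (reduce h1 a) := ha
    exact ⟨isRegular_of_simple h1 h2 ha'.act_one_ne_zero, ha'.hasRootDensities⟩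
  | t111 =>
    have ha' : IsType111 (reduce h1 a) := ha
    exact ⟨isRegular_of_simple h1 h2 ha'.act_one_ne_zero, ha'.hasRootDensities⟩
  | t121max =>
    obtain ⟨g, b, hb0, hb1, hb2, hb3, hab⟩ : IsType121Max p (reduce h2 a) := ha
    have ht := (isUnit_iff_castHom_ne_zero h _).1 hb1
    have hb : reduce h b = ![0, ZMod.castHom h (ZMod p) (b 1), 0, 0] := by
      ext i
      fin_cases i
      · exact (congrArg _ hb0).trans (map_zero _)
      · rfl
      · exact castHom_eq_zero_of_mem_pMul hb2
      · exact castHom_eq_zero_of_mem_pMul (pMulUnits_subset hb3)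
    refine ⟨isRegular_of_reduce_eq_act h1 h2 hab hb2 hb3 (h := h) fun k h0 h1 => ?_,
      hasRootDensities_of_reduce_eq_act h1 h2 h hab ?_⟩
    · rw [hb] at h0 h1
      exact (act_square_mul ht k).1.1 ⟨h0, h1⟩
    · rw [hb]
      exact hasRootDensities_square_mul ht
  | t13max =>
    obtain ⟨g, b, hb0, hb1, hb2, hb3, hab⟩ : IsType13Max p (reduce h2 a) := ha
    have ht := (isUnit_iff_castHom_ne_zero h _).1 hb0
    have hb : reduce h b = ![ZMod.castHom h (ZMod p) (b 0), 0, 0, 0] := by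
      ext i
      fin_cases i
      · rfl
      · exact castHom_eq_zero_of_mem_pMul hb1
      · exact castHom_eq_zero_of_mem_pMul hb2
      · exact castHom_eq_zero_of_mem_pMul (pMulUnits_subset hb3)
    refine ⟨isRegular_of_reduce_eq_act h1 h2 hab hb2 hb3 (h := h) fun k h0 _ => ?_,
      hasRootDensities_of_reduce_eq_act h1 h2 h hab ?_⟩
    · rw [hb] at h0
      exact (act_cube ht k).1.1 h0
    · rw [hb]
      exact hasRootDensities_cube ht

end Level

/-! ### The distribution of the leading coefficient over an orbit -/

section LeadingCoefficient

section

variable {R : Type*} [CommRing R]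

/-- The proportion of the `g ∈ GL₂(R)` for which `g a` has leading coefficient `c`. -/
noncomputable def leadDensity (a : Form R) (c : R) : ℂ :=
  density fun g : GL (Fin 2) R => act g a 0 = c

/-- This torus scales the leading coefficient by any unit while fixing the second one, so it
preserves the distinction between simple and multiple roots. -/
theorem act_diagGL_one_mul_zero (u : Rˣ) (g : GL (Fin 2) R)
    (a : Form R) :
    act (diagGL 1 u⁻¹ * g) a 0 = u * act g a 0 ∧
      act (diagGL 1 u⁻¹ * g) a 1 = act g a 1 := by
  rw [act_mul, act_diagGL]
  simp

theorem leadDensity_unit_mul (a : Form R) (u : Rˣ) (c : R) :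
    leadDensity a (u * c) = leadDensity a c := by
  rw [leadDensity, leadDensity,
    ← density_mul_left (fun g : GL (Fin 2) R => act g a 0 = u * c) (diagGL 1 u⁻¹)]
  refine density_congr fun g => ?_
  rw [(act_diagGL_one_mul_zero u g a).1, u.mul_right_inj]

/-- The proportion of the `g ∈ GL₂(R)` with `g b = a`. -/
noncomputable def orbitDensity (a b : Form R) : ℂ :=
  density fun g : GL (Fin 2) R => act g b = a

/-- Inverting $g$ exchanges source and target. The fixed form `a` becomes the one that is moved, and
its coefficients can then be studied as random variables. -/
theorem orbitDensity_eq (a b : Form R) :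
    orbitDensity a b = density fun g : GL (Fin 2) R => act g a = b := by
  rw [← density_inv, orbitDensity]
  exact density_congr fun g => (act_inv_eq_iff g a b).symm

theorem orbitDensity_act (a b : Form R) (h : GL (Fin 2) R) :
    orbitDensity a (act h b) = orbitDensity a b := by
  simp only [orbitDensity, ← act_mul]
  exact density_mul_right (fun g : GL (Fin 2) R => act g b = a) h

end

variable {p e : ℕ} [hp : Fact p.Prime]

theorem map_castHom_surjective (h1 : p ∣ p ^ e) : Function.Surjective
    (Matrix.GeneralLinearGroup.map (n := Fin 2) (ZMod.castHom h1 (ZMod p))) :=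
  have := isLocalHom_castHom h1
  map_surjective_of_isLocalHom _ (ZMod.castHom_surjective h1)

section

variable (h1 : p ∣ p ^ e) (a : Form (ZMod (p ^ e)))

/-- The point `g⁻¹ (1 : 0)` is a simple root of `a` modulo `p`. -/
def IsSimpleAt (g : GL (Fin 2) (ZMod (p ^ e))) : Prop :=
  ZMod.castHom h1 (ZMod p) (act g a 0) = 0 ∧ ZMod.castHom h1 (ZMod p) (act g a 1) ≠ 0

/-- The point `g⁻¹ (1 : 0)` is a multiple root of `a` modulo `p`. -/
def IsMultipleAt (g : GL (Fin 2) (ZMod (p ^ e))) : Prop :=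
  ZMod.castHom h1 (ZMod p) (act g a 0) = 0 ∧ ZMod.castHom h1 (ZMod p) (act g a 1) = 0

variable {h1 a}

theorem density_isSimpleAt {N D : ℂ} (ha : HasRootDensities (reduce h1 a) N D) :
    density (IsSimpleAt h1 a) = N * ((p : ℂ) + 1)⁻¹ := by
  have h := ha.1
  rw [← density_map _ (map_castHom_surjective h1)] at h
  simp only [act_reduce, Nat.card_zmod] at h
  exact h

theorem density_isMultipleAt {N D : ℂ} (ha : HasRootDensities (reduce h1 a) N D) :
    density (IsMultipleAt h1 a) = D * ((p : ℂ) + 1)⁻¹ := by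
  have h := ha.2
  rw [← density_map _ (map_castHom_surjective h1)] at h
  simp only [act_reduce, Nat.card_zmod] at h
  exact h

theorem density_isUnit {N D : ℂ} (ha : HasRootDensities (reduce h1 a) N D) :
    density (fun g => IsUnit (act g a 0)) = 1 - (N + D) * ((p : ℂ) + 1)⁻¹ := by
  have hA := density_and_add_density_and_not
    (fun g => ZMod.castHom h1 (ZMod p) (act g a 0) = 0)
    (fun g => ZMod.castHom h1 (ZMod p) (act g a 1) = 0)
  have hB := density_and_add_density_and_not (fun _ : GL (Fin 2) (ZMod (p ^ e)) => True)
    (fun g => ZMod.castHom h1 (ZMod p) (act g a 0) = 0)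
  rw [density_true (fun _ => trivial)] at hB
  have hS := density_isSimpleAt ha
  have hM := density_isMultipleAt ha
  simp only [true_and] at hB
  change density (IsMultipleAt h1 a) + density (IsSimpleAt h1 a) = _ at hA
  rw [density_congr fun g => isUnit_iff_castHom_ne_zero h1 (act g a 0)]
  linear_combination hB + hA - hS - hM

theorem card_units_zmod (h1 : p ∣ p ^ e) :
    (Nat.card (ZMod (p ^ e))ˣ : ℂ) = (p : ℂ) ^ e - (p : ℂ) ^ e / p := by
  have he : 0 < e := Nat.pos_of_ne_zero fun h0 => hp.out.one_lt.ne' (by simpa [h0] using h1)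
  have hp0 : (p : ℂ) ≠ 0 := Nat.cast_ne_zero.2 hp.out.ne_zero
  rw [Nat.card_eq_fintype_card, ZMod.card_units_eq_totient, Nat.totient_prime_pow hp.out he]
  obtain ⟨k, rfl⟩ := Nat.exists_eq_succ_of_ne_zero he.ne'
  rw [Nat.cast_mul, Nat.cast_pow, Nat.cast_sub hp.out.one_le]
  simp only [Nat.succ_eq_add_one, Nat.add_sub_cancel, pow_succ, Nat.cast_one]
  field_simp

/-- All unit values are equally likely by torus invariance, and together they account for the
non-roots. -/
theorem leadDensity_one {N D : ℂ} (ha : HasRootDensities (reduce h1 a) N D) :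
    ((p : ℂ) ^ e - (p : ℂ) ^ e / p) * leadDensity a 1 = 1 - (N + D) * ((p : ℂ) + 1)⁻¹ := by
  rw [← density_isUnit ha, ← card_units_zmod h1,
    ← sum_density _ (fun (u : (ZMod (p ^ e))ˣ) g => act g a 0 = u)
      (fun g hg => ⟨hg.unit, rfl, fun u hu => Units.ext hu.symm⟩)]
  have : ∀ u : (ZMod (p ^ e))ˣ, density (fun g => IsUnit (act g a 0) ∧ act g a 0 = u) =
      leadDensity a 1 := fun u => by
    rw [← leadDensity_unit_mul a u 1, mul_one]
    exact density_congr fun g => ⟨fun h => h.2, fun h => ⟨h ▸ u.isUnit, h⟩⟩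
  simp only [this, Finset.sum_const, Finset.card_univ, nsmul_eq_mul, Nat.card_eq_fintype_card]

theorem isSimpleAt_upperGL_mul {s : ZMod (p ^ e)} (hs : ZMod.castHom h1 (ZMod p) s = 0)
    (g : GL (Fin 2) (ZMod (p ^ e))) : IsSimpleAt h1 a (upperGL s * g) ↔ IsSimpleAt h1 a g := by
  simp only [IsSimpleAt, act_mul, act_upperGL, Matrix.cons_val, map_add, map_mul, map_pow, hs]
  simp

/-- Hensel's lemma for the restriction of a form to a neighbourhood of a simple root. -/
theorem existsUnique_act_upperGL {b : Form (ZMod (p ^ e))} {c : ZMod (p ^ e)}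
    (hb0 : ZMod.castHom h1 (ZMod p) (b 0) = 0) (hb1 : ZMod.castHom h1 (ZMod p) (b 1) ≠ 0)
    (hc : ZMod.castHom h1 (ZMod p) c = 0) :
    ∃! s : {s : ZMod (p ^ e) // ZMod.castHom h1 (ZMod p) s = 0}, act (upperGL s.1) b 0 = c := by
  -- A self-map of the finite set $p\mathbb Z/p^e$, so injectivity gives bijectivity.
  let f : {s : ZMod (p ^ e) // ZMod.castHom h1 (ZMod p) s = 0} →
      {s : ZMod (p ^ e) // ZMod.castHom h1 (ZMod p) s = 0} := fun s =>
    ⟨act (upperGL s.1) b 0, by simp [act_upperGL, hb0, s.2, -ZMod.castHom_apply]⟩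
  have hf : Function.Injective f := by
    intro s t hst
    have h : b 0 + s.1 * b 1 + s.1 ^ 2 * b 2 + s.1 ^ 3 * b 3 =
        b 0 + t.1 * b 1 + t.1 ^ 2 * b 2 + t.1 ^ 3 * b 3 := by
      simpa [f, act_upperGL] using congrArg Subtype.val hst
    -- The difference of two values is $s-t$ times this factor, which is congruent to $b_1$ modulo
    -- $p$.
    have hu : IsUnit (b 1 + (s.1 + t.1) * b 2 + (s.1 ^ 2 + s.1 * t.1 + t.1 ^ 2) * b 3) := by
      rw [isUnit_iff_castHom_ne_zero h1]
      simp only [map_add, map_mul, map_pow, s.2, t.2]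
      simpa [-ZMod.castHom_apply] using hb1
    have h0 : (b 1 + (s.1 + t.1) * b 2 + (s.1 ^ 2 + s.1 * t.1 + t.1 ^ 2) * b 3) *
        (s.1 - t.1) = 0 := by
      linear_combination h
    rw [hu.mul_right_eq_zero, sub_eq_zero] at h0
    exact Subtype.ext h0
  obtain ⟨s, hs⟩ := (Finite.injective_iff_surjective.1 hf) ⟨c, hc⟩
  refine ⟨s, congrArg Subtype.val hs, fun t ht => hf (Subtype.ext ?_)⟩
  exact ht.trans (congrArg Subtype.val hs).symm

/-- Left translation by unipotents trivial modulo $p$ preserves simplicity of the root. By Hensel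
exactly one translate of each `g` has leading coefficient `c`, so the $p^{e-1}$ equal densities add
up to the total. -/
theorem density_isSimpleAt_and {N D : ℂ} (ha : HasRootDensities (reduce h1 a) N D)
    {c : ZMod (p ^ e)} (hc : ZMod.castHom h1 (ZMod p) c = 0) :
    (p : ℂ) ^ e / p * density (fun g => IsSimpleAt h1 a g ∧ act g a 0 = c) =
      N * ((p : ℂ) + 1)⁻¹ := by
  classical
  rw [← density_isSimpleAt ha, ← Nat.cast_pow, ← card_castHom_eq_zero h1,
    ← sum_density (IsSimpleAt h1 a)
      (fun (s : {s : ZMod (p ^ e) // ZMod.castHom h1 (ZMod p) s = 0}) g =>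
        act (upperGL s.1) (act g a) 0 = c) (fun g hg => existsUnique_act_upperGL hg.1 hg.2 hc)]
  have : ∀ s : {s : ZMod (p ^ e) // ZMod.castHom h1 (ZMod p) s = 0},
      density (fun g => IsSimpleAt h1 a g ∧ act (upperGL s.1) (act g a) 0 = c) =
      density (fun g => IsSimpleAt h1 a g ∧ act g a 0 = c) := fun s => by
    rw [← density_mul_left (fun g => IsSimpleAt h1 a g ∧ act g a 0 = c) (upperGL s.1)]
    simp only [isSimpleAt_upperGL_mul s.2, act_mul]
  simp only [this, Finset.sum_const, Finset.card_univ, nsmul_eq_mul, Nat.card_eq_fintype_card]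

theorem exists_unit_mul_eq (h2 : p ^ 2 ∣ p ^ e) {c : ZMod (p ^ e)}
    (hc1 : ZMod.castHom h1 (ZMod p) c = 0) (hc2 : ZMod.castHom h2 (ZMod (p ^ 2)) c ≠ 0) :
    ∃ u : (ZMod (p ^ e))ˣ, c = u * p := by
  obtain ⟨y, rfl⟩ := (castHom_eq_zero_iff h1 c).1 hc1
  have hy : IsUnit y := by
    rw [isUnit_iff_castHom_ne_zero h1]
    intro h
    obtain ⟨z, rfl⟩ := (castHom_eq_zero_iff h1 y).1 h
    refine hc2 ((castHom_eq_zero_iff h2 _).2 ⟨z, ?_⟩)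
    rw [Nat.cast_pow]
    ring
  exact ⟨hy.unit, by simp [mul_comm]⟩

/-- Regularity confines the value to $p$ times units. There are $p^{e-1}-p^{e-2}$ of these residues,
and the torus permutes them transitively. -/
theorem density_isMultipleAt_and (h2 : p ^ 2 ∣ p ^ e) {N D : ℂ}
    (ha : HasRootDensities (reduce h1 a) N D) (hreg : IsRegular h1 h2 a) :
    ((p : ℂ) ^ e / p - (p : ℂ) ^ e / p ^ 2) *
      density (fun g => IsMultipleAt h1 a g ∧ act g a 0 = p) = D * ((p : ℂ) + 1)⁻¹ := by
  classical
  let ι := {c : ZMod (p ^ e) // ZMod.castHom h1 (ZMod p) c = 0 ∧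
    ZMod.castHom h2 (ZMod (p ^ 2)) c ≠ 0}
  have hle : ∀ c, ZMod.castHom h2 (ZMod (p ^ 2)) c = 0 → ZMod.castHom h1 (ZMod p) c = 0 :=
    fun c hc => by
      rw [← castHom_castHom h2 (dvd_pow_self p two_ne_zero), hc, map_zero]
  have hι : (Nat.card ι : ℂ) = (p : ℂ) ^ e / p - (p : ℂ) ^ e / p ^ 2 := by
    have hA := density_and_add_density_and_not (fun c => ZMod.castHom h1 (ZMod p) c = 0)
      (fun c => ZMod.castHom h2 (ZMod (p ^ 2)) c = 0)
    rw [density_congr (Q := fun c => ZMod.castHom h2 (ZMod (p ^ 2)) c = 0)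
      (fun c => ⟨fun h => h.2, fun h => ⟨hle c h, h⟩⟩)] at hA
    simp only [density, card_castHom_eq_zero] at hA
    rw [← add_div, div_left_inj' (by simp [hp.out.ne_zero])] at hA
    push_cast at hA
    rw [← hA]
    exact (add_sub_cancel_left _ _).symm
  rw [← density_isMultipleAt ha, ← hι, ← sum_density (IsMultipleAt h1 a)
    (fun (c : ι) g => act g a 0 = c.1)
    (fun g hg => ⟨⟨act g a 0, hg.1, hreg g hg.1 hg.2⟩, rfl, fun c hc => Subtype.ext hc.symm⟩)]
  have : ∀ c : ι, density (fun g => IsMultipleAt h1 a g ∧ act g a 0 = c.1) =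
      density (fun g => IsMultipleAt h1 a g ∧ act g a 0 = p) := fun c => by
    obtain ⟨u, hu⟩ := exists_unit_mul_eq h2 c.2.1 c.2.2
    rw [hu, ← density_mul_left (fun g => IsMultipleAt h1 a g ∧ act g a 0 = u * p)
      (diagGL 1 u⁻¹)]
    refine density_congr fun g => ?_
    rw [IsMultipleAt, (act_diagGL_one_mul_zero u g a).1, (act_diagGL_one_mul_zero u g a).2,
      u.mul_right_inj, map_mul, ((u.isUnit).map _).mul_right_eq_zero]
    rfl
  simp only [this, Finset.sum_const, Finset.card_univ, nsmul_eq_mul, Nat.card_eq_fintype_card]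

theorem leadDensity_eq_add {c : ZMod (p ^ e)} (hc : ZMod.castHom h1 (ZMod p) c = 0) :
    leadDensity a c = density (fun g => IsSimpleAt h1 a g ∧ act g a 0 = c) +
      density (fun g => IsMultipleAt h1 a g ∧ act g a 0 = c) := by
  rw [leadDensity, ← density_and_add_density_and_not (fun g => act g a 0 = c)
    (fun g => ZMod.castHom h1 (ZMod p) (act g a 1) = 0), add_comm]
  congr 1
  · refine density_congr fun g => ⟨?_, ?_⟩
    · rintro ⟨rfl, h⟩
      exact ⟨⟨hc, h⟩, rfl⟩
    · rintro ⟨⟨_, h⟩, rfl⟩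
      exact ⟨rfl, h⟩
  · refine density_congr fun g => ⟨?_, ?_⟩
    · rintro ⟨rfl, h⟩
      exact ⟨⟨hc, h⟩, rfl⟩
    · rintro ⟨⟨_, h⟩, rfl⟩
      exact ⟨rfl, h⟩

theorem leadDensity_prime (h2 : p ^ 2 ∣ p ^ e) {N D : ℂ}
    (ha : HasRootDensities (reduce h1 a) N D) (hreg : IsRegular h1 h2 a) :
    leadDensity a p = N * ((p : ℂ) + 1)⁻¹ / ((p : ℂ) ^ e / p) +
      D * ((p : ℂ) + 1)⁻¹ / ((p : ℂ) ^ e / p - (p : ℂ) ^ e / p ^ 2) := by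
  have hc : ZMod.castHom h1 (ZMod p) (p : ZMod (p ^ e)) = 0 := by
    rw [map_natCast, ZMod.natCast_self]
  have hp0 : (p : ℂ) ≠ 0 := Nat.cast_ne_zero.2 hp.out.ne_zero
  have hp1 : (p : ℂ) - 1 ≠ 0 := sub_ne_zero.2 (Nat.cast_ne_one.2 hp.out.ne_one)
  rw [leadDensity_eq_add hc, ← density_isSimpleAt_and ha hc, ← density_isMultipleAt_and h2 ha hreg,
    mul_div_cancel_left₀, mul_div_cancel_left₀]
  · rw [show (p : ℂ) ^ e / p - (p : ℂ) ^ e / p ^ 2 = (p : ℂ) ^ e * (p - 1) / p ^ 2 by field_simp]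
    positivity
  · positivity

/-- Multiple roots contribute nothing by regularity, and the simple-root contribution does not
depend on the residue. -/
theorem leadDensity_eq_of_sq_dvd (h2 : p ^ 2 ∣ p ^ e) {N D : ℂ}
    (ha : HasRootDensities (reduce h1 a) N D) (hreg : IsRegular h1 h2 a) {c : ZMod (p ^ e)}
    (hc : ZMod.castHom h2 (ZMod (p ^ 2)) c = 0) :
    leadDensity a c = N * ((p : ℂ) + 1)⁻¹ / ((p : ℂ) ^ e / p) := by
  have hc1 : ZMod.castHom h1 (ZMod p) c = 0 := by
    rw [← castHom_castHom h2 (dvd_pow_self p two_ne_zero), hc, map_zero]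
  have hp0 : (p : ℂ) ≠ 0 := Nat.cast_ne_zero.2 hp.out.ne_zero
  rw [leadDensity_eq_add hc1, density_false (P := fun g => IsMultipleAt h1 a g ∧ act g a 0 = c),
    add_zero, ← density_isSimpleAt_and ha hc1, mul_div_cancel_left₀]
  · positivity
  · rintro g ⟨hg, rfl⟩
    exact hreg g hg.1 hg.2 hc

end

/-! ### Orbit densities -/

theorem sum_orbitDensity_three (a : Form (ZMod (p ^ e))) (c : ZMod (p ^ e)) :
    ∑ u : Fin 3 → ZMod (p ^ e), orbitDensity a ![c, u 0, u 1, u 2] = leadDensity a c := by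
  rw [leadDensity, ← sum_density _ (fun (u : Fin 3 → ZMod (p ^ e)) g =>
    ![act g a 1, act g a 2, act g a 3] = u) (fun g _ => ⟨_, rfl, fun u hu => hu.symm⟩)]
  refine Finset.sum_congr rfl fun u _ => ?_
  rw [orbitDensity_eq]
  refine density_congr fun g => ⟨fun h => ?_, ?_⟩
  · rw [h]
    refine ⟨rfl, ?_⟩
    ext i
    fin_cases i <;> rfl
  · rintro ⟨rfl, rfl⟩
    ext i
    fin_cases i <;> rfl

/-- A form in the orbit of `a` with these two coefficients would have a multiple root modulo $p$
with value exactly $0$, contrary to regularity. -/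
theorem orbitDensity_eq_zero {h1 : p ∣ p ^ e} {h2 : p ^ 2 ∣ p ^ e} {a : Form (ZMod (p ^ e))}
    (hreg : IsRegular h1 h2 a) {b : Form (ZMod (p ^ e))} (hb0 : b 0 = 0) (hb1 : ¬ IsUnit (b 1)) :
    orbitDensity a b = 0 := by
  rw [orbitDensity_eq]
  refine density_false ?_
  rintro g rfl
  rw [isUnit_iff_castHom_ne_zero h1, not_not] at hb1
  exact hreg g (by rw [hb0, map_zero]) hb1 (by rw [hb0, map_zero])

theorem sum_orbitDensity_two_of_not_isUnit {h1 : p ∣ p ^ e} {h2 : p ^ 2 ∣ p ^ e}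
    {a : Form (ZMod (p ^ e))} (hreg : IsRegular h1 h2 a) {t : ZMod (p ^ e)} (ht : ¬ IsUnit t) :
    ∑ u : Fin 2 → ZMod (p ^ e), orbitDensity a ![0, t, u 0, u 1] = 0 :=
  Finset.sum_eq_zero fun _ _ => orbitDensity_eq_zero hreg rfl ht

/-- The torus element $\mathrm{diag}(t,1)$ moves second coefficient $1$ to $t$ and scales the last
coefficient by $t^{-1}$, which only reindexes the sum. -/
theorem sum_orbitDensity_two_unit (a : Form (ZMod (p ^ e))) (t : (ZMod (p ^ e))ˣ) :
    ∑ u : Fin 2 → ZMod (p ^ e), orbitDensity a ![0, (t : ZMod (p ^ e)), u 0, u 1] =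
      ∑ u : Fin 2 → ZMod (p ^ e), orbitDensity a ![0, 1, u 0, u 1] := by
  have h : ∀ u : Fin 2 → ZMod (p ^ e), orbitDensity a ![0, 1, u 0, u 1] =
      orbitDensity a ![0, (t : ZMod (p ^ e)), u 0, (t⁻¹ : (ZMod (p ^ e))ˣ) * u 1] := fun u => by
    rw [← orbitDensity_act a _ (diagGL t 1), act_diagGL]
    simp
  simp only [h]
  let φ : (Fin 2 → ZMod (p ^ e)) ≃ (Fin 2 → ZMod (p ^ e)) :=
    { toFun := fun u => ![u 0, (t⁻¹ : (ZMod (p ^ e))ˣ) * u 1]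
      invFun := fun u => ![u 0, t * u 1]
      left_inv := fun u => by ext i; fin_cases i <;> simp
      right_inv := fun u => by ext i; fin_cases i <;> simp }
  exact (φ.sum_comp fun u => orbitDensity a ![0, (t : ZMod (p ^ e)), u 0, u 1]).symm

/-- Summing also over the second coefficient gives `leadDensity a 0`. Nonunits contribute zero and
units contribute equally. -/
theorem sum_orbitDensity_two_of_isUnit {h1 : p ∣ p ^ e} {h2 : p ^ 2 ∣ p ^ e}
    {a : Form (ZMod (p ^ e))} (hreg : IsRegular h1 h2 a) {t : ZMod (p ^ e)} (ht : IsUnit t) :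
    ((p : ℂ) ^ e - (p : ℂ) ^ e / p) *
      ∑ u : Fin 2 → ZMod (p ^ e), orbitDensity a ![0, t, u 0, u 1] = leadDensity a 0 := by
  classical
  obtain ⟨t, rfl⟩ := ht
  rw [sum_orbitDensity_two_unit, ← card_units_zmod h1, ← sum_orbitDensity_three a 0]
  let φ : (ZMod (p ^ e) × (Fin 2 → ZMod (p ^ e))) ≃ (Fin 3 → ZMod (p ^ e)) :=
    Fin.consEquiv fun _ => ZMod (p ^ e)
  rw [← φ.sum_comp, Fintype.sum_prod_type]
  change _ = ∑ s, ∑ u : Fin 2 → ZMod (p ^ e), orbitDensity a ![0, s, u 0, u 1]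
  have hsum : ∀ s : ZMod (p ^ e), ∑ u : Fin 2 → ZMod (p ^ e), orbitDensity a ![0, s, u 0, u 1] =
      if IsUnit s then ∑ u : Fin 2 → ZMod (p ^ e), orbitDensity a ![0, 1, u 0, u 1] else 0 :=
    fun s => by
      split_ifs with hs
      · obtain ⟨v, rfl⟩ := hs
        exact sum_orbitDensity_two_unit a v
      · exact sum_orbitDensity_two_of_not_isUnit hreg hs
  rw [Finset.sum_congr rfl fun s _ => hsum s, ← Finset.sum_filter, Finset.sum_const,
    nsmul_eq_mul, ← Fintype.card_subtype, ← Nat.card_eq_fintype_card]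
  congr 2
  exact Nat.card_congr (Equiv.ofBijective
    (fun u : (ZMod (p ^ e))ˣ => (⟨u, u.isUnit⟩ : {x : ZMod (p ^ e) // IsUnit x}))
    ⟨fun u v h => Units.ext (congrArg Subtype.val h), fun x => ⟨x.2.unit, rfl⟩⟩)

end LeadingCoefficient

/-! ### The local component of the idele class character at an unramified prime -/

section LocalChar

theorem rat_eq_one_of_padicValRat {q : ℚ} (hq : 0 < q)
    (h : ∀ l : ℕ, l.Prime → padicValRat l q = 0) : q = 1 := by
  have hnum : q.num.natAbs ≠ 0 := by simpa using hq.ne'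
  have key : ∀ l : ℕ, l.Prime → padicValNat l q.num.natAbs = padicValNat l q.den := fun l hl => by
    have := h l hl
    rw [padicValRat, padicValInt, sub_eq_zero] at this
    exact_mod_cast this
  have hdvd : ∀ l : ℕ, l.Prime → (l ∣ q.num.natAbs ↔ l ∣ q.den) := fun l hl => by
    have : Fact l.Prime := ⟨hl⟩
    rw [dvd_iff_padicValNat_ne_zero hnum, dvd_iff_padicValNat_ne_zero q.den_nz, key l hl]
  have h1 : q.num.natAbs = 1 := by
    refine Nat.eq_one_iff_not_exists_prime_dvd.2 fun l hl hd => ?_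
    exact Nat.not_coprime_of_dvd_of_dvd hl.one_lt hd ((hdvd l hl).1 hd) q.reduced
  have h2 : q.den = 1 := by
    refine Nat.eq_one_iff_not_exists_prime_dvd.2 fun l hl hd => ?_
    exact Nat.not_coprime_of_dvd_of_dvd hl.one_lt ((hdvd l hl).2 hd) hd q.reduced
  have h3 : 0 < q.num := Rat.num_pos.2 hq
  have h4 : q.num = 1 := by omega
  rw [← Rat.num_div_den q, h4, h2]
  simp

theorem rat_eq_zpow_of_padicValRat {p : ℕ} [hp : Fact p.Prime] {q : ℚ} (hq : 0 < q)
    (h : ∀ l : ℕ, l.Prime → l ≠ p → padicValRat l q = 0) : q = (p : ℚ) ^ padicValRat p q := by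
  have hp0 : (0 : ℚ) < p := Nat.cast_pos.2 hp.out.pos
  have : q * ((p : ℚ) ^ padicValRat p q)⁻¹ = 1 := by
    refine rat_eq_one_of_padicValRat (by positivity) fun l hl => ?_
    have : Fact l.Prime := ⟨hl⟩
    rw [padicValRat.mul hq.ne' (by positivity), padicValRat.inv, padicValRat.zpow,
      padicValRat.of_nat]
    by_cases hlp : l = p
    · subst hlp
      simp
    · rw [h l hl hlp, padicValNat_primes hlp]
      simp
  exact eq_of_mul_inv_eq_one this

theorem valuation_coe_unit {p : ℕ} [Fact p.Prime] (u : ℤ_[p]ˣ) : (u : ℤ_[p]).valuation = 0 := by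
  by_contra h0
  have h := PadicInt.norm_units u
  rw [PadicInt.norm_eq_zpow_neg_valuation u.ne_zero] at h
  have hp : (1 : ℝ) < p := Nat.one_lt_cast.2 (Fact.out : p.Prime).one_lt
  exact (zpow_lt_one_of_neg₀ hp (by omega)).ne h

theorem zhatMod_congr {m : ℕ} [NeZero m] {u v : ∀ l : FinPlace, ℤ_[l.val]}
    (h : ∀ l : FinPlace, l.val ∣ m → u l = v l) : zhatMod m u = zhatMod m v := by
  have : ∀ l : m.primeFactors, u ⟨l, Nat.prime_of_mem_primeFactors l.2⟩ =
      v ⟨l, Nat.prime_of_mem_primeFactors l.2⟩ := fun l => h _ (Nat.dvd_of_mem_primeFactors l.2)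
  simp only [zhatMod, RingHom.comp_apply]
  congr 1
  ext l
  simp [this]

variable (p : ℕ) [hp : Fact p.Prime]

theorem norm_natCast_prime_of_ne {l : ℕ} [hl : Fact l.Prime] (h : l ≠ p) :
    ‖(p : ℚ_[l])‖ = 1 := by
  have := padicNorm.padicNorm_of_prime_of_ne (p := l) (q := p) h
  rw [← Rat.cast_natCast, Padic.eq_padicNorm, this, Rat.cast_one]

theorem exists_isIdeleDecomposition (t : ℚ_[p]ˣ) :
    ∃ d, IsIdeleDecomposition 1
      (Pi.mulSingle (M := fun l : FinPlace => ℚ_[l.val]ˣ) ⟨p, hp.out⟩ t) d := by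
  classical
  have hp0 : (0 : ℚ) < p := Nat.cast_pos.2 hp.out.pos
  set k := (t : ℚ_[p]).valuation with hk
  -- The rational part must carry the whole valuation at $p$; the real factor $p^{-k}$ compensates
  -- at infinity.
  let q : ℚˣ := Units.mk0 ((p : ℚ) ^ k) (by positivity)
  set x := Pi.mulSingle (M := fun l : FinPlace => ℚ_[l.val]ˣ) ⟨p, hp.out⟩ t with hx
  have hnorm : ∀ l : FinPlace, ‖(x l : ℚ_[l.val]) * (((q : ℚ) : ℚ_[l.val]))⁻¹‖ = 1 := by
    intro l
    by_cases hl : l = ⟨p, hp.out⟩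
    · subst hl
      rw [hx, Pi.mulSingle_eq_same, norm_mul, norm_inv]
      simp only [q, Units.val_mk0, Rat.cast_zpow, Rat.cast_natCast, norm_zpow]
      rw [Padic.norm_eq_zpow_neg_valuation t.ne_zero, ← hk, Padic.norm_p]
      have : (0 : ℝ) < p := Nat.cast_pos.2 hp.out.pos
      rw [inv_zpow, inv_inv, zpow_neg, inv_mul_cancel₀]
      positivity
    · have hlp : l.val ≠ p := fun h => hl (FinPlace.ext h)
      rw [hx, Pi.mulSingle_eq_of_ne hl]
      simp [q, norm_natCast_prime_of_ne p hlp]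
  refine ⟨((p : ℝ) ^ (-k), fun l => PadicInt.mkUnits (hnorm l), q), ?_, ?_, ?_⟩
  · have : (0 : ℝ) < p := Nat.cast_pos.2 hp.out.pos
    positivity
  · have : (p : ℝ) ≠ 0 := Nat.cast_ne_zero.2 hp.out.ne_zero
    simp only [q, Units.val_one, Units.val_mk0, Rat.cast_zpow, Rat.cast_natCast, zpow_neg]
    rw [inv_mul_cancel₀ (zpow_ne_zero _ this)]
  · intro l
    have hq : ((q : ℚ) : ℚ_[l.val]) ≠ 0 := Rat.cast_ne_zero.2 q.ne_zero
    rw [PadicInt.mkUnits_eq, inv_mul_cancel_right₀ hq]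

/-- The real place fixes the sign of the rational part and the finite places fix its valuations.
This makes the value of `ideleChar` independent of the chosen decomposition. -/
theorem isIdeleDecomposition_rat_eq {t : ℚ_[p]ˣ} {d : ℝ × (∀ l : FinPlace, ℤ_[l.val]ˣ) × ℚˣ}
    (hd : IsIdeleDecomposition 1
      (Pi.mulSingle (M := fun l : FinPlace => ℚ_[l.val]ˣ) ⟨p, hp.out⟩ t) d) :
    (d.2.2 : ℚ) = (p : ℚ) ^ (t : ℚ_[p]).valuation := by
  classical
  obtain ⟨hr, h1, hl⟩ := hd
  have hq : 0 < (d.2.2 : ℚ) := by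
    have : (0 : ℝ) < d.1 * ((d.2.2 : ℚ) : ℝ) := by
      rw [← h1]
      simp
    exact_mod_cast (pos_iff_pos_of_mul_pos this).1 hr
  have hval : ∀ l : FinPlace, padicValRat l.val (d.2.2 : ℚ) = ((Pi.mulSingle
      (M := fun l : FinPlace => ℚ_[l.val]ˣ) ⟨p, hp.out⟩ t l : ℚ_[l.val]ˣ) :
        ℚ_[l.val]).valuation := fun l => by
    have hu : (((d.2.1 l : ℤ_[l.val]ˣ) : ℤ_[l.val]) : ℚ_[l.val]).valuation = 0 := by
      rw [PadicInt.valuation_coe, valuation_coe_unit, Nat.cast_zero]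
    have hu0 : (((d.2.1 l : ℤ_[l.val]ˣ) : ℤ_[l.val]) : ℚ_[l.val]) ≠ 0 := by
      simp
    rw [hl l, Padic.valuation_mul hu0 (Rat.cast_ne_zero.2 d.2.2.ne_zero), hu, zero_add,
      Padic.valuation_ratCast]
  rw [rat_eq_zpow_of_padicValRat (p := p) hq, hval ⟨p, hp.out⟩, Pi.mulSingle_eq_same]
  intro l hl' hlp
  have hne : (⟨l, hl'⟩ : FinPlace) ≠ ⟨p, hp.out⟩ := fun h => hlp (congrArg FinPlace.val h)
  rw [hval ⟨l, hl'⟩, Pi.mulSingle_eq_of_ne hne]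
  simp

/-- The local component at an unramified prime `p` is the unramified character with
`p ↦ χ(p)⁻¹`. -/
theorem localChar_eq {m : ℕ} [NeZero m] (χ : DirichletCharacter ℂ m) (hm : ¬ p ∣ m)
    (t : ℚ_[p]ˣ) : localChar χ p t = χ p ^ (-(t : ℚ_[p]).valuation) := by
  classical
  have hex := exists_isIdeleDecomposition p t
  rw [localChar, ideleChar, dif_pos hex]
  have hd := hex.choose_spec
  have hq := isIdeleDecomposition_rat_eq p hd
  have hl := hd.2.2
  generalize hex.choose = d at hd hq hl
  -- The idele is $1$ away from $p$, so for $l\mid m$ the unit component is $p^{-v(t)}$; here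
  -- $p\nmid m$ is needed.
  have hu : ∀ l : FinPlace, l.val ∣ m → (((d.2.1 l : ℤ_[l.val]ˣ) : ℤ_[l.val]) : ℚ_[l.val]) *
      (p : ℚ_[l.val]) ^ (t : ℚ_[p]).valuation = 1 := fun l hlm => by
    have hne : l ≠ ⟨p, hp.out⟩ := by
      rintro rfl
      exact hm hlm
    have := hl l
    rw [Pi.mulSingle_eq_of_ne hne, hq] at this
    push_cast at this
    exact this.symm
  generalize (t : ℚ_[p]).valuation = k at hu
  obtain ⟨n, rfl | rfl⟩ := k.eq_nat_or_neg
  · have h1 : zhatMod m (fun l => ((d.2.1 l : ℤ_[l.val]ˣ) : ℤ_[l.val])) * (p : ZMod m) ^ n = 1 := by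
      rw [← map_natCast (zhatMod m) p, ← map_pow, ← map_mul, ← map_one (zhatMod m)]
      refine zhatMod_congr fun l hlm => ?_
      have := hu l hlm
      rw [zpow_natCast] at this
      apply PadicInt.ext
      simpa using this
    rw [zpow_neg, zpow_natCast]
    refine eq_inv_of_mul_eq_one_left ?_
    rw [← map_pow, ← map_mul, h1, map_one]
  · have h1 : zhatMod m (fun l => ((d.2.1 l : ℤ_[l.val]ˣ) : ℤ_[l.val])) = (p : ZMod m) ^ n := by
      rw [← map_natCast (zhatMod m) p, ← map_pow]
      refine zhatMod_congr fun l hlm => ?_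
      have := hu l hlm
      rw [zpow_neg, zpow_natCast, mul_inv_eq_one₀ (pow_ne_zero _
        (Nat.cast_ne_zero.2 hp.out.ne_zero))] at this
      apply PadicInt.ext
      simpa using this
    rw [neg_neg, zpow_natCast, h1, map_pow]

end LocalChar

/-! ### Averages over `GL₂(ℤ_p)` -/

section Average

variable (p : ℕ) [hp : Fact p.Prime] {e : ℕ}

theorem toZModPow_surjective (e : ℕ) : Function.Surjective (PadicInt.toZModPow (p := p) e) :=
  fun x => ⟨(x.val : ℤ_[p]), by rw [map_natCast, ZMod.natCast_zmod_val]⟩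

theorem isOpen_toZModPow_eq (e : ℕ) (c : ZMod (p ^ e)) :
    IsOpen {x : ℤ_[p] | PadicInt.toZModPow e x = c} := by
  have hpos : (0 : ℝ) < (p : ℝ) ^ (-(e : ℤ)) := by
    have : (0 : ℝ) < p := Nat.cast_pos.2 hp.out.pos
    positivity
  rw [Metric.isOpen_iff]
  intro x hx
  refine ⟨_, hpos, fun y hy => ?_⟩
  rw [Metric.mem_ball, dist_eq_norm] at hy
  have := (PadicInt.norm_le_pow_iff_mem_span_pow (y - x) e).1 hy.le
  rw [← PadicInt.ker_toZModPow, RingHom.mem_ker, map_sub, sub_eq_zero] at this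
  exact this.trans hx

theorem isLocalHom_toZModPow (he : e ≠ 0) : IsLocalHom (PadicInt.toZModPow (p := p) e) :=
  have : Fact (1 < p ^ e) := ⟨Nat.one_lt_pow he hp.out.one_lt⟩
  Function.Surjective.isLocalHom _ (toZModPow_surjective p e)

/-- Reduction modulo `p ^ e` on `GL₂(ℤ_p)`. -/
noncomputable def redGL (e : ℕ) : GL (Fin 2) ℤ_[p] →* GL (Fin 2) (ZMod (p ^ e)) :=
  Matrix.GeneralLinearGroup.map (PadicInt.toZModPow e)

theorem redGL_surjective (he : e ≠ 0) : Function.Surjective (redGL p e) :=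
  have := isLocalHom_toZModPow p he
  map_surjective_of_isLocalHom _ (toZModPow_surjective p e)

theorem measurableSet_redGL_eq (h : GL (Fin 2) (ZMod (p ^ e))) :
    MeasurableSet {g | redGL p e g = h} := by
  apply IsOpen.measurableSet
  have : {g | redGL p e g = h} =
      ⋂ (i : Fin 2) (j : Fin 2), {g | PadicInt.toZModPow e (g.val i j) = h.val i j} := by
    ext g
    simp only [Set.mem_iInter, Set.mem_ofPred_eq]
    constructor
    · rintro rfl i j
      rfl
    · intro hg
      ext i j
      exact hg i j
  rw [this]
  refine isOpen_iInter_of_finite fun i => isOpen_iInter_of_finite fun j => ?_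
  exact (isOpen_toZModPow_eq p e (h.val i j)).preimage
    (Units.continuous_val.matrix_elem i j)

instance : (haarGL p).IsMulLeftInvariant := Measure.isMulLeftInvariant_haarMeasure _

instance : IsProbabilityMeasure (haarGL p) :=
  ⟨Measure.haarMeasure_self (K₀ := (⊤ : TopologicalSpace.PositiveCompacts (GL (Fin 2) ℤ_[p])))⟩

/-- Haar measure pushes forward to the uniform measure, since left invariance equates the fibres of
reduction. -/
theorem haarGL_redGL_eq (he : e ≠ 0) (h : GL (Fin 2) (ZMod (p ^ e))) :
    (haarGL p).real {g | redGL p e g = h} = (Nat.card (GL (Fin 2) (ZMod (p ^ e))) : ℝ)⁻¹ := by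
  have key : ∀ k, (haarGL p).real {g | redGL p e g = k} =
      (haarGL p).real {g | redGL p e g = h} := fun k => by
    obtain ⟨x, hx⟩ := redGL_surjective p he (h * k⁻¹)
    rw [measureReal_def, measureReal_def, ← measure_preimage_mul _ x {g | redGL p e g = h}]
    congr 2
    ext g
    simp only [Set.mem_preimage, Set.mem_ofPred_eq, map_mul, hx]
    rw [mul_assoc, mul_eq_left, inv_mul_eq_one, eq_comm]
  have hs : (haarGL p).real (⋃ k ∈ (Finset.univ : Finset (GL (Fin 2) (ZMod (p ^ e)))),
      {g | redGL p e g = k}) = _ :=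
    measureReal_biUnion_finset (fun i _ j _ hij => Set.disjoint_left.2 fun g hi hj =>
      hij (hi.symm.trans hj)) (fun k _ => measurableSet_redGL_eq p k)
  simp only [key, Finset.sum_const, Finset.card_univ, nsmul_eq_mul] at hs
  have hu : (⋃ k ∈ (Finset.univ : Finset (GL (Fin 2) (ZMod (p ^ e)))),
      {g | redGL p e g = k}) = Set.univ := by
    ext g
    simp
  rw [hu, probReal_univ, ← Nat.card_eq_fintype_card] at hs
  exact eq_inv_of_mul_eq_one_right hs.symm

theorem integral_redGL (he : e ≠ 0) (P : GL (Fin 2) (ZMod (p ^ e)) → Prop) [DecidablePred P] :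
    ∫ g, (if P (redGL p e g) then (1 : ℂ) else 0) ∂(haarGL p) = density P := by
  classical
  have h1 : ∀ g, (if P (redGL p e g) then (1 : ℂ) else 0) =
      ∑ k, Set.indicator {g | redGL p e g = k} (fun _ => if P k then (1 : ℂ) else 0) g := by
    intro g
    rw [Finset.sum_eq_single (redGL p e g)]
    · simp
    · intro k _ hk
      simp [Ne.symm hk]
    · simp
  simp only [h1]
  rw [integral_finsetSum _ fun k _ =>
    (integrable_const _).indicator (measurableSet_redGL_eq p k)]
  simp only [integral_indicator_const _ (measurableSet_redGL_eq p _), haarGL_redGL_eq p he]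
  rw [density, Nat.card_eq_fintype_card (α := {g // P g}), Fintype.card_subtype, ← Finset.smul_sum,
    Finset.sum_boole]
  simp [div_eq_inv_mul]

/-! ### Averages of the characteristic function of a residue class -/

theorem charFun_coe (a : Form (ZMod (p ^ e))) (y : Form ℤ_[p]) :
    charFun p e a (fun i => (y i : ℚ_[p])) =
      if (fun i => PadicInt.toZModPow e (y i)) = a then 1 else 0 := by
  classical
  rw [charFun]
  congr 1
  simp only [eq_iff_iff]
  constructor
  · rintro ⟨z, hz, hza⟩
    ext i
    rw [← hza i, PadicInt.ext (hz i)]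
  · rintro rfl
    exact ⟨y, fun _ => rfl, fun _ => rfl⟩

theorem toGLQp_act_coe (g : GL (Fin 2) ℤ_[p]) (y : Form ℤ_[p]) :
    act (toGLQp p g) (fun i => (y i : ℚ_[p])) = fun i => ((act g y i : ℤ_[p]) : ℚ_[p]) :=
  act_map PadicInt.Coe.ringHom g y

theorem charFun_eq_zero (a : Form (ZMod (p ^ e))) {x : Form ℚ_[p]}
    (hx : ¬ ∃ y : Form ℤ_[p], x = fun i => (y i : ℚ_[p])) : charFun p e a x = 0 := by
  rw [charFun, if_neg]
  rintro ⟨y, hy, _⟩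
  exact hx ⟨y, funext hy⟩

variable {m : ℕ} [NeZero m] (χ : DirichletCharacter ℂ m)

theorem localChar_det_eq_one (hm : ¬ p ∣ m) (g : GL (Fin 2) ℤ_[p]) :
    localChar χ p (Matrix.GeneralLinearGroup.det (toGLQp p g)) = 1 := by
  have h : ((Matrix.GeneralLinearGroup.det (toGLQp p g) : ℚ_[p]ˣ) : ℚ_[p]) =
      (((Matrix.GeneralLinearGroup.det g : ℤ_[p]ˣ) : ℤ_[p]) : ℚ_[p]) := by
    rw [toGLQp, Matrix.GeneralLinearGroup.map_det]
    rfl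
  rw [localChar_eq p χ hm, h, PadicInt.valuation_coe]
  rw [valuation_coe_unit]
  simp

theorem average_coe (hm : ¬ p ∣ m) (he : e ≠ 0) (a : Form (ZMod (p ^ e))) (y : Form ℤ_[p]) :
    average p χ (charFun p e a) (fun i => (y i : ℚ_[p])) =
      orbitDensity a fun i => PadicInt.toZModPow e (y i) := by
  classical
  rw [orbitDensity, ← integral_redGL p he, average]
  congr 1
  ext g
  rw [localChar_det_eq_one p χ hm, one_mul, toGLQp_act_coe, charFun_coe]
  congr 2
  exact (act_map (PadicInt.toZModPow e) g y).symm

/-- Integral matrices with integral inverse preserve non-integrality. -/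
theorem average_eq_zero (a : Form (ZMod (p ^ e))) {x : Form ℚ_[p]}
    (hx : ¬ ∃ y : Form ℤ_[p], x = fun i => (y i : ℚ_[p])) :
    average p χ (charFun p e a) x = 0 := by
  have h : ∀ g, charFun p e a (act (toGLQp p g) x) = 0 := fun g => by
    apply charFun_eq_zero
    rintro ⟨y, hy⟩
    refine hx ⟨act g⁻¹ y, ?_⟩
    rw [← toGLQp_act_coe, ← hy, ← act_mul, toGLQp, toGLQp, ← map_mul, inv_mul_cancel, map_one,
      act_one]
  rw [average]
  simp [h]

end Average

/-! ### Volumes of residue classes -/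

section Volumes

variable (p : ℕ) [hp : Fact p.Prime] {e : ℕ}

/-- The residue class of `c` modulo `p ^ e`, as a subset of `ℚ_p`. -/
def residueClass (c : ZMod (p ^ e)) : Set ℚ_[p] :=
  {x | ∃ y : ℤ_[p], x = y ∧ PadicInt.toZModPow e y = c}

variable {p}

theorem coe_mem_residueClass (y : ℤ_[p]) (c : ZMod (p ^ e)) :
    (y : ℚ_[p]) ∈ residueClass p c ↔ PadicInt.toZModPow e y = c :=
  ⟨fun ⟨z, hz, hc⟩ => by rw [PadicInt.ext hz, hc], fun h => ⟨y, rfl, h⟩⟩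

variable (p)

theorem isOpen_residueClass (c : ZMod (p ^ e)) : IsOpen (residueClass p c) := by
  have h2 := PadicInt.isOpenEmbedding_coe.isOpenMap _ (isOpen_toZModPow_eq p e c)
  convert h2 using 1
  ext x
  constructor
  · rintro ⟨y, rfl, hy⟩
    exact ⟨y, hy, rfl⟩
  · rintro ⟨y, hy, rfl⟩
    exact ⟨y, rfl, hy⟩

theorem measurableSet_residueClass (c : ZMod (p ^ e)) : MeasurableSet (residueClass p c) :=
  (isOpen_residueClass p c).measurableSet

instance : (haarQp p).IsAddHaarMeasure := by
  unfold haarQp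
  infer_instance

instance : (haarQpUnits p).IsHaarMeasure := by
  unfold haarQpUnits
  infer_instance

instance : SecondCountableTopology ℚ_[p]ˣ :=
  (Units.isEmbedding_val₀ (G₀ := ℚ_[p])).secondCountableTopology

instance : SigmaFinite (haarQpUnits p) :=
  have : SigmaCompactSpace ℚ_[p]ˣ := sigmaCompactSpace_of_locallyCompact_secondCountable
  inferInstance

theorem iUnion_residueClass : (⋃ c ∈ (Finset.univ : Finset (ZMod (p ^ e))), residueClass p c) =
    Metric.closedBall 0 1 := by
  ext x
  simp only [Finset.mem_univ, Set.iUnion_true, Set.mem_iUnion, mem_closedBall_zero_iff]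
  constructor
  · rintro ⟨c, y, rfl, _⟩
    exact y.2
  · intro hx
    exact ⟨_, ⟨x, hx⟩, rfl, rfl⟩

theorem haarQp_residueClass (c : ZMod (p ^ e)) :
    (haarQp p).real (residueClass p c) = ((p : ℝ) ^ e)⁻¹ := by
  have hclosed : haarQp p (Metric.closedBall 0 1) = 1 :=
    Measure.addHaarMeasure_self (K₀ := zpCompacts p)
  have hle : ∀ d : ZMod (p ^ e), haarQp p (residueClass p d) ≠ ⊤ := fun d => by
    refine ((measure_mono ?_).trans_lt (hclosed ▸ ENNReal.one_lt_top)).ne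
    rintro x ⟨y, rfl, _⟩
    exact mem_closedBall_zero_iff.2 y.2
  have key : ∀ d : ZMod (p ^ e), (haarQp p).real (residueClass p d) =
      (haarQp p).real (residueClass p c) := fun d => by
    obtain ⟨y, hy⟩ := toZModPow_surjective p e (c - d)
    rw [measureReal_def, measureReal_def,
      ← measure_preimage_add (haarQp p) (y : ℚ_[p]) (residueClass p c)]
    congr 2
    ext x
    constructor
    · rintro ⟨z, rfl, hz⟩
      exact ⟨y + z, by simp, by rw [map_add, hy, hz, sub_add_cancel]⟩
    · rintro ⟨z, hz, hzc⟩
      refine ⟨z - y, ?_, by rw [map_sub, hzc, hy, sub_sub_cancel]⟩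
      rw [PadicInt.coe_sub, ← hz, add_sub_cancel_left]
  have hs : (haarQp p).real (⋃ d ∈ (Finset.univ : Finset (ZMod (p ^ e))), residueClass p d) = _ :=
    measureReal_biUnion_finset (fun i _ j _ hij => Set.disjoint_left.2 fun x => by
      rintro ⟨y, rfl, hy⟩ hj
      exact hij (hy.symm.trans ((coe_mem_residueClass y j).1 hj)))
      (fun d _ => measurableSet_residueClass p d) (fun d _ => hle d)
  simp only [key, Finset.sum_const, Finset.card_univ, nsmul_eq_mul] at hs
  rw [iUnion_residueClass, measureReal_def, hclosed, ENNReal.toReal_one, ZMod.card] at hs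
  rw [← Nat.cast_pow]
  exact eq_inv_of_mul_eq_one_right hs.symm

/-- The valuation of a unit of `ℚ_p`. -/
noncomputable def unitVal (t : ℚ_[p]ˣ) : ℤ := (t : ℚ_[p]).valuation

theorem isOpen_unitVal_eq (k : ℤ) : IsOpen {t : ℚ_[p]ˣ | unitVal p t = k} := by
  have hp1 : (1 : ℝ) < p := Nat.one_lt_cast.2 hp.out.one_lt
  have h0 : (p : ℝ) ^ (-k) ≠ 0 := by positivity
  have h := (IsUltrametricDist.isOpen_sphere (0 : ℚ_[p]) h0).preimage Units.continuous_val
  convert h using 1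
  ext t
  simp only [Set.mem_ofPred_eq, Set.mem_preimage, mem_sphere_zero_iff_norm, unitVal]
  rw [Padic.norm_eq_zpow_neg_valuation t.ne_zero, zpow_right_inj₀ (by positivity) hp1.ne', neg_inj]

theorem haarQpUnits_unitVal_eq (k : ℤ) : haarQpUnits p {t : ℚ_[p]ˣ | unitVal p t = k} = 1 := by
  have hp0 : (p : ℚ_[p]) ≠ 0 := Nat.cast_ne_zero.2 hp.out.ne_zero
  have h1 : haarQpUnits p {t : ℚ_[p]ˣ | ‖(t : ℚ_[p])‖ = 1} = 1 :=
    Measure.haarMeasure_self (K₀ := zpUnitsCompacts p)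
  rw [← h1, ← measure_preimage_mul (haarQpUnits p) (Units.mk0 (p : ℚ_[p]) hp0 ^ (-k))
    {t : ℚ_[p]ˣ | ‖(t : ℚ_[p])‖ = 1}]
  congr 1
  ext t
  have hp1 : (1 : ℝ) < p := Nat.one_lt_cast.2 hp.out.one_lt
  simp only [Set.mem_ofPred_eq, Set.mem_preimage, unitVal, Units.val_mul,
    Units.val_zpow_eq_zpow_val, Units.val_mk0, norm_mul, norm_zpow, Padic.norm_p]
  rw [Padic.norm_eq_zpow_neg_valuation t.ne_zero, inv_zpow', neg_neg,
    ← zpow_add₀ (by positivity), ← zpow_zero (p : ℝ), zpow_right_inj₀ (by positivity) hp1.ne',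
    ← sub_eq_add_neg, sub_eq_zero, eq_comm]

theorem measurable_unitVal : Measurable (unitVal p) :=
  measurable_to_countable' fun k => (isOpen_unitVal_eq p k).measurableSet

/-- Each valuation shell is a translate of $\mathbb Z_p^\times$, of volume $1$. Integrals of
functions of $v(t)$ thus become sums over $\mathbb Z$. -/
theorem map_unitVal : (haarQpUnits p).map (unitVal p) = Measure.count := by
  rw [Measure.ext_iff_singleton]
  intro k
  rw [Measure.map_apply (measurable_unitVal p) (measurableSet_singleton k),
    Measure.count_singleton]
  exact haarQpUnits_unitVal_eq p k

theorem integrable_comp_unitVal {F : ℤ → ℂ} (hF : Summable fun k => ‖F k‖) :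
    Integrable (fun t => F (unitVal p t)) (haarQpUnits p) := by
  have h : Integrable F ((haarQpUnits p).map (unitVal p)) := by
    rw [map_unitVal]
    exact integrable_count_iff.2 hF
  exact h.comp_measurable (measurable_unitVal p)

theorem integral_comp_unitVal {F : ℤ → ℂ} (hF : Summable fun k => ‖F k‖) :
    ∫ t, F (unitVal p t) ∂(haarQpUnits p) = ∑' k, F k := by
  rw [← integral_map (measurable_unitVal p).aemeasurable
    (measurable_of_countable F).aestronglyMeasurable, map_unitVal,
    integral_countable (integrable_count_iff.2 hF)]
  simp

/-- The extension by zero of a sequence to the integers. -/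
noncomputable def extendInt (Q : ℕ → ℂ) (k : ℤ) : ℂ := if 0 ≤ k then Q k.toNat else 0

theorem extendInt_natCast (Q : ℕ → ℂ) (k : ℕ) : extendInt Q k = Q k := by
  simp [extendInt]

theorem extendInt_of_notMem_range (Q : ℕ → ℂ) {k : ℤ} (hk : k ∉ Set.range ((↑) : ℕ → ℤ)) :
    extendInt Q k = 0 := by
  rw [extendInt, if_neg]
  exact fun h => hk ⟨k.toNat, Int.toNat_of_nonneg h⟩

theorem summable_extendInt {Q : ℕ → ℂ} (hQ : Summable fun k => ‖Q k‖) :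
    Summable fun k => ‖extendInt Q k‖ := by
  rw [← (Nat.cast_injective (R := ℤ)).summable_iff
    (fun k hk => by rw [extendInt_of_notMem_range Q hk, norm_zero])]
  simpa [Function.comp_def, extendInt_natCast] using hQ

theorem tsum_extendInt (Q : ℕ → ℂ) : ∑' k, extendInt Q k = ∑' k, Q k := by
  rw [← (Nat.cast_injective (R := ℤ)).tsum_eq]
  · simp only [extendInt_natCast]
  · intro k hk
    by_contra h
    exact hk (extendInt_of_notMem_range Q h)

variable {p}

theorem unitVal_eq {t : ℚ_[p]ˣ} {s : ℤ_[p]} (h : (t : ℚ_[p]) = s) : unitVal p t = s.valuation := by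
  rw [unitVal, h, PadicInt.valuation_coe]

theorem unitVal_neg {t : ℚ_[p]ˣ} (h : ¬ ∃ s : ℤ_[p], (t : ℚ_[p]) = s) : ¬ 0 ≤ unitVal p t := by
  rw [unitVal, ← Padic.norm_le_one_iff_val_nonneg]
  exact fun ht => h ⟨⟨t, ht⟩, rfl⟩

variable (p)

/-- The function `t ↦ η ^ v(t) w(t mod p ^ e)` on nonzero `p`-adic integers, extended by zero. -/
noncomputable def twistedClassFun (η : ℂ) (w : ZMod (p ^ e) → ℂ) (t : ℚ_[p]ˣ) : ℂ :=
  ∑ d, Set.indicator (Units.val ⁻¹' residueClass p d)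
    (fun t => extendInt (fun k => η ^ k) (unitVal p t) * w d) t

theorem twistedClassFun_eq (η : ℂ) (w : ZMod (p ^ e) → ℂ) {t : ℚ_[p]ˣ} {s : ℤ_[p]}
    (h : (t : ℚ_[p]) = s) :
    twistedClassFun p η w t = η ^ s.valuation * w (PadicInt.toZModPow e s) := by
  rw [twistedClassFun, Finset.sum_eq_single (PadicInt.toZModPow e s)]
  · rw [Set.indicator_of_mem, unitVal_eq h, extendInt_natCast]
    rw [Set.mem_preimage, h, coe_mem_residueClass]
  · intro d _ hd
    rw [Set.indicator_of_notMem]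
    rw [Set.mem_preimage, h, coe_mem_residueClass]
    exact hd.symm
  · simp

theorem twistedClassFun_eq_zero (η : ℂ) (w : ZMod (p ^ e) → ℂ) {t : ℚ_[p]ˣ}
    (h : ¬ ∃ s : ℤ_[p], (t : ℚ_[p]) = s) : twistedClassFun p η w t = 0 := by
  refine Finset.sum_eq_zero fun d _ => Set.indicator_of_notMem ?_ _
  rintro ⟨y, hy, _⟩
  exact h ⟨y, hy⟩

theorem integrable_twistedClassFun {η : ℂ} (hη : ‖η‖ < 1) (w : ZMod (p ^ e) → ℂ) :
    Integrable (twistedClassFun p η w) (haarQpUnits p) := by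
  refine integrable_finsetSum _ fun d _ => Integrable.indicator ?_
    ((measurableSet_residueClass p d).preimage Units.continuous_val.measurable)
  refine (integrable_comp_unitVal p (summable_extendInt ?_)).mul_const _
  simpa using summable_geometric_of_lt_one (norm_nonneg η) hη

/-- The integral over `ℚ_pˣ × ℚ_p ^ n` of a function supported on integral points and given there
by `η ^ v(t)` times a function of the residue classes. -/
theorem integrable_and_integral_prodHaar (n : ℕ) {η : ℂ} (hη : ‖η‖ < 1)
    (W : ZMod (p ^ e) → (Fin n → ZMod (p ^ e)) → ℂ) (Ψ : ℚ_[p]ˣ × (Fin n → ℚ_[p]) → ℂ)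
    (h1 : ∀ (t : ℚ_[p]ˣ) (s : ℤ_[p]) (u : Fin n → ℤ_[p]), (t : ℚ_[p]) = s →
      Ψ (t, fun i => (u i : ℚ_[p])) = η ^ s.valuation *
        W (PadicInt.toZModPow e s) fun i => PadicInt.toZModPow e (u i))
    (h0 : ∀ (t : ℚ_[p]ˣ) (u : Fin n → ℚ_[p]), Ψ (t, u) ≠ 0 →
      (∃ s : ℤ_[p], (t : ℚ_[p]) = s) ∧ ∃ v : Fin n → ℤ_[p], u = fun i => (v i : ℚ_[p]))
    (Q : ℕ → ℂ)
    (hQ : ∀ s : ℤ_[p], s ≠ 0 → ∑ c, W (PadicInt.toZModPow e s) c = Q s.valuation)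
    (hQs : Summable fun k => ‖η ^ k * Q k‖) :
    Integrable Ψ (prodHaar p n) ∧
      ∫ z, Ψ z ∂(prodHaar p n) = ((p : ℂ) ^ (n * e))⁻¹ * ∑' k, η ^ k * Q k := by
  let g : (Fin n → ZMod (p ^ e)) → (Fin n → ℚ_[p]) → ℂ := fun c =>
    Set.indicator (Set.univ.pi fun i => residueClass p (c i)) fun _ => 1
  have g1 : ∀ c u, (∀ i, u i ∈ residueClass p (c i)) → g c u = 1 := fun c u h =>
    Set.indicator_of_mem (Set.mem_univ_pi.2 h) _
  have g0 : ∀ c u, ¬ (∀ i, u i ∈ residueClass p (c i)) → g c u = 0 := fun c u h =>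
    Set.indicator_of_notMem (fun h' => h (Set.mem_univ_pi.1 h')) _
  have hmeas : ∀ c : Fin n → ZMod (p ^ e),
      MeasurableSet (Set.univ.pi fun i => residueClass p (c i)) := fun c =>
    MeasurableSet.univ_pi fun i => measurableSet_residueClass p (c i)
  have hvol : ∀ c : Fin n → ZMod (p ^ e), (Measure.pi fun _ : Fin n => haarQp p).real
      (Set.univ.pi fun i => residueClass p (c i)) = ((p : ℝ) ^ (n * e))⁻¹ := fun c => by
    rw [measureReal_def, Measure.pi_pi, ENNReal.toReal_prod]
    simp only [← measureReal_def, haarQp_residueClass, Finset.prod_const, Finset.card_univ,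
      Fintype.card_fin]
    rw [inv_pow, ← pow_mul, mul_comm]
  have hg : ∀ c, Integrable (g c) (Measure.pi fun _ : Fin n => haarQp p) := fun c => by
    refine (integrable_indicator_iff (hmeas c)).2 (integrableOn_const ?_)
    intro htop
    have := hvol c
    rw [measureReal_def, htop, ENNReal.toReal_top] at this
    have hp0 : (0 : ℝ) < p := Nat.cast_pos.2 hp.out.pos
    exact (by positivity : (0 : ℝ) < ((p : ℝ) ^ (n * e))⁻¹).ne this
  have hgi : ∀ c, ∫ u, g c u ∂(Measure.pi fun _ : Fin n => haarQp p) =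
      ((p : ℂ) ^ (n * e))⁻¹ := fun c => by
    rw [integral_indicator_const _ (hmeas c), hvol]
    simp
  have hf := fun c => integrable_twistedClassFun p hη fun d => W d c
  -- Splitting by the residues of `u` writes `Ψ` as a finite sum of products of a function of `t`
  -- and the indicator of a box, to which Fubini applies termwise.
  have hΨ : Ψ = fun z => ∑ c, twistedClassFun p η (fun d => W d c) z.1 * g c z.2 := by
    ext ⟨t, u⟩
    by_cases hs : ∃ s : ℤ_[p], (t : ℚ_[p]) = s
    · by_cases hv : ∃ v : Fin n → ℤ_[p], u = fun i => (v i : ℚ_[p])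
      · obtain ⟨s, hs⟩ := hs
        obtain ⟨v, rfl⟩ := hv
        rw [h1 t s v hs, Finset.sum_eq_single fun i => PadicInt.toZModPow e (v i)]
        · rw [twistedClassFun_eq p η _ hs, g1 _ _ fun i => (coe_mem_residueClass _ _).2 rfl,
            mul_one]
        · intro c _ hc
          refine mul_eq_zero_of_right _ (g0 _ _ fun h => hc ?_)
          exact funext fun i => ((coe_mem_residueClass _ _).1 (h i)).symm
        · simp
      · rw [not_imp_comm.1 (h0 t u) fun h => hv h.2, Finset.sum_eq_zero]
        intro c _
        refine mul_eq_zero_of_right _ (g0 _ _ fun h => ?_)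
        choose v hv' _ using h
        exact hv ⟨v, funext hv'⟩
    · rw [not_imp_comm.1 (h0 t u) fun h => hs h.1, Finset.sum_eq_zero]
      intro c _
      rw [twistedClassFun_eq_zero p η _ hs, zero_mul]
  have hint : ∀ c, Integrable (fun z : ℚ_[p]ˣ × (Fin n → ℚ_[p]) =>
      twistedClassFun p η (fun d => W d c) z.1 * g c z.2) (prodHaar p n) :=
    fun c => (hf c).mul_prod (hg c)
  rw [hΨ]
  refine ⟨integrable_finsetSum _ fun c _ => hint c, ?_⟩
  rw [integral_finsetSum _ fun c _ => hint c]
  simp only [prodHaar, integral_prod_mul, hgi]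
  -- All boxes have the same volume, so the sum over residues goes back inside the `t`-integral,
  -- where `hQ` makes it a function of $v(t)$ alone.
  rw [← Finset.sum_mul, ← integral_finsetSum _ fun c _ => hf c, mul_comm, ← tsum_extendInt,
    ← integral_comp_unitVal p (summable_extendInt hQs)]
  congr 2
  ext t
  by_cases hs : ∃ s : ℤ_[p], (t : ℚ_[p]) = s
  · obtain ⟨s, hs⟩ := hs
    have hs0 : s ≠ 0 := by
      rintro rfl
      simp at hs
    simp only [twistedClassFun_eq p η _ hs]
    rw [← Finset.mul_sum, hQ s hs0, unitVal_eq hs, extendInt_natCast]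
  · simp only [twistedClassFun_eq_zero p η _ hs]
    rw [extendInt, if_neg (unitVal_neg hs)]
    simp

end Volumes

/-! ### Evaluation of the local factors -/

section Evaluation

theorem summable_and_tsum_eventually_geometric {η : ℂ} (hη : ‖η‖ < 1) {Q : ℕ → ℂ} {c : ℂ}
    (hQ : ∀ k, 2 ≤ k → Q k = c) :
    (Summable fun k => ‖η ^ k * Q k‖) ∧
      ∑' k, η ^ k * Q k = Q 0 + η * Q 1 + η ^ 2 * c * (1 - η)⁻¹ := by
  have h2 : ∀ k, η ^ (k + 2) * Q (k + 2) = η ^ 2 * c * η ^ k := fun k => by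
    rw [hQ (k + 2) (by omega)]
    ring
  have hs : Summable fun k => ‖η ^ k * Q k‖ := by
    rw [← summable_nat_add_iff 2]
    simp only [h2, norm_mul, norm_pow]
    exact (summable_geometric_of_lt_one (norm_nonneg η) hη).mul_left _
  refine ⟨hs, ?_⟩
  rw [← hs.of_norm.sum_add_tsum_nat_add 2]
  simp only [h2]
  rw [tsum_mul_left, tsum_geometric_of_norm_lt_one hη, Finset.sum_range_succ, Finset.sum_range_one]
  ring

theorem cpow_neg_third (p : ℕ) :
    (p : ℂ) ^ (-(1 / 3) : ℂ) = (((p : ℝ) ^ (-(1 / 3) : ℝ) : ℝ) : ℂ) := by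
  rw [Complex.ofReal_cpow (Nat.cast_nonneg p)]
  push_cast
  rfl

theorem cpow_neg_third_pow_three (p : ℕ) : ((p : ℂ) ^ (-(1 / 3) : ℂ)) ^ 3 = (p : ℂ)⁻¹ := by
  rw [← Complex.cpow_nat_mul, ← Complex.cpow_neg_one]
  norm_num

theorem cpow_neg_two_thirds (p : ℕ) :
    (p : ℂ) ^ (-(2 / 3) : ℂ) = ((p : ℂ) ^ (-(1 / 3) : ℂ)) ^ 2 := by
  rw [← Complex.cpow_nat_mul]
  norm_num

theorem cpow_neg_four_thirds (p : ℕ) [Fact p.Prime] :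
    (p : ℂ) ^ (-(4 / 3) : ℂ) = (p : ℂ)⁻¹ * (p : ℂ) ^ (-(1 / 3) : ℂ) := by
  rw [← cpow_neg_third_pow_three, ← pow_succ, ← Complex.cpow_nat_mul]
  norm_num

theorem char_pow_three {p m : ℕ} [hp : Fact p.Prime] {χ : DirichletCharacter ℂ m}
    (hcubic : χ ^ 3 = 1) (hm : ¬ p ∣ m) : χ p ^ 3 = 1 := by
  have hu : IsUnit (p : ZMod m) := ZMod.isUnit_prime_of_not_dvd hp.out hm
  rw [← MulChar.pow_apply' _ three_ne_zero, hcubic, MulChar.one_apply hu]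

theorem char_inv {p m : ℕ} [Fact p.Prime] {χ : DirichletCharacter ℂ m}
    (hcubic : χ ^ 3 = 1) (hm : ¬ p ∣ m) : (χ p)⁻¹ = χ p ^ 2 :=
  inv_eq_of_mul_eq_one_left (by rw [← pow_succ]; exact char_pow_three hcubic hm)

/-- The complex number `χ(p)² p^{-1/3}`. -/
noncomputable def frobRoot (p : ℕ) {m : ℕ} (χ : DirichletCharacter ℂ m) : ℂ :=
  χ p ^ 2 * (p : ℂ) ^ (-(1 / 3) : ℂ)

/-- Since $\chi(p)^3=1$, the character disappears from the cube. This relation turns the table into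
polynomial identities in $\omega$ and $p$. -/
theorem frobRoot_pow_three {p m : ℕ} [hp : Fact p.Prime]
    {χ : DirichletCharacter ℂ m} (hcubic : χ ^ 3 = 1) (hm : ¬ p ∣ m) :
    frobRoot p χ ^ 3 = (p : ℂ)⁻¹ := by
  rw [frobRoot, mul_pow, cpow_neg_third_pow_three, ← pow_mul, mul_comm 2 3, pow_mul,
    char_pow_three hcubic hm, one_pow, one_mul]

theorem frobRoot_sq {p m : ℕ} [hp : Fact p.Prime]
    {χ : DirichletCharacter ℂ m} (hcubic : χ ^ 3 = 1) (hm : ¬ p ∣ m) :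
    frobRoot p χ ^ 2 = χ p * (p : ℂ) ^ (-(2 / 3) : ℂ) := by
  rw [frobRoot, cpow_neg_two_thirds, mul_pow, ← pow_mul, show 2 * 2 = 3 + 1 from rfl, pow_succ,
    char_pow_three hcubic hm, one_mul]

theorem norm_frobRoot_lt_one {p m : ℕ} [hp : Fact p.Prime]
    {χ : DirichletCharacter ℂ m} (hcubic : χ ^ 3 = 1) (hm : ¬ p ∣ m) :
    ‖frobRoot p χ‖ < 1 := by
  have h : ‖frobRoot p χ‖ ^ 3 < 1 := by
    rw [← norm_pow, frobRoot_pow_three hcubic hm, norm_inv, Complex.norm_natCast]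
    exact inv_lt_one_of_one_lt₀ (Nat.one_lt_cast.2 hp.out.one_lt)
  exact (pow_lt_one_iff_of_nonneg (norm_nonneg _) three_ne_zero).1 h

/-- This factor is exactly the denominator of the geometric tail in the $\mathcal C$-integral. -/
theorem localL_inv {p m : ℕ} [hp : Fact p.Prime]
    {χ : DirichletCharacter ℂ m} (hcubic : χ ^ 3 = 1) (hm : ¬ p ∣ m) :
    (localL (1 / 3) χ⁻¹ p)⁻¹ = 1 - frobRoot p χ := by
  rw [localL, if_neg hm, inv_inv, MulChar.inv_apply_eq_inv', char_inv hcubic hm, frobRoot,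
    Complex.cpow_neg, div_eq_mul_inv]

variable {p e m : ℕ} [hp : Fact p.Prime] [NeZero m]

theorem leadDensity_toZModPow (a : Form (ZMod (p ^ e))) {s : ℤ_[p]} (hs : s ≠ 0) :
    leadDensity a (PadicInt.toZModPow e s) = leadDensity a ((p : ZMod (p ^ e)) ^ s.valuation) := by
  have h := PadicInt.unitCoeff_spec hs
  have h2 : PadicInt.toZModPow e s =
      (Units.map (PadicInt.toZModPow (p := p) e).toMonoidHom (PadicInt.unitCoeff hs) :
        (ZMod (p ^ e))ˣ) * (p : ZMod (p ^ e)) ^ s.valuation := by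
    conv_lhs => rw [h]
    rw [map_mul, map_pow, map_natCast]
    rfl
  rw [h2, leadDensity_unit_mul]

theorem isUnit_toZModPow_iff (he : e ≠ 0) {s : ℤ_[p]} (hs : s ≠ 0) :
    IsUnit (PadicInt.toZModPow e s) ↔ s.valuation = 0 := by
  have := isLocalHom_toZModPow p he
  rw [isUnit_map_iff]
  constructor
  · rintro ⟨u, rfl⟩
    exact valuation_coe_unit u
  · intro h
    rw [PadicInt.unitCoeff_spec hs, h, pow_zero, mul_one]
    exact Units.isUnit _

theorem rpow_norm_third {s : ℤ_[p]} (hs : s ≠ 0) :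
    ((‖(s : ℚ_[p])‖ ^ (1 / 3 : ℝ) : ℝ) : ℂ) = ((p : ℂ) ^ (-(1 / 3) : ℂ)) ^ s.valuation := by
  rw [cpow_neg_third, ← Complex.ofReal_pow]
  congr 1
  rw [← PadicInt.norm_def, PadicInt.norm_eq_zpow_neg_valuation hs, ← Real.rpow_natCast,
    ← Real.rpow_intCast, ← Real.rpow_mul (Nat.cast_nonneg p), ← Real.rpow_mul (Nat.cast_nonneg p)]
  congr 1
  push_cast
  ring

section Character

variable {χ : DirichletCharacter ℂ m}

/-- From $\chi(p)^{-1}=\chi(p)^2$ one gets $\tilde\chi_p(t)|t|_p^{1/3}=\omega^{v(t)}$ with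
$\omega=\chi(p)^2p^{-1/3}$. -/
theorem integrandC_coe (hcubic : χ ^ 3 = 1) (hm : ¬ p ∣ m)
    (he : e ≠ 0) (a : Form (ZMod (p ^ e))) (t : ℚ_[p]ˣ) (s : ℤ_[p])
    (u : Fin 3 → ℤ_[p]) (hts : (t : ℚ_[p]) = s) :
    integrandC p e a χ (t, fun i => (u i : ℚ_[p])) = frobRoot p χ ^ s.valuation *
      orbitDensity a ![PadicInt.toZModPow e s, PadicInt.toZModPow e (u 0),
        PadicInt.toZModPow e (u 1), PadicInt.toZModPow e (u 2)] := by
  have hs0 : s ≠ 0 := by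
    rintro rfl
    simp at hts
  have hx : (![(t : ℚ_[p]), (u 0 : ℚ_[p]), (u 1 : ℚ_[p]), (u 2 : ℚ_[p])] : Form ℚ_[p]) =
      fun i => ((![s, u 0, u 1, u 2] : Form ℤ_[p]) i : ℚ_[p]) := by
    ext i
    fin_cases i
    · exact hts
    · rfl
    · rfl
    · rfl
  simp only [integrandC]
  rw [hx, average_coe p χ⁻¹ hm he, localChar_eq p χ hm, hts, rpow_norm_third hs0,
    PadicInt.valuation_coe, zpow_neg, zpow_natCast, ← inv_pow, char_inv hcubic hm, ← mul_pow,
    frobRoot]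
  congr 2
  ext i
  fin_cases i <;> rfl

theorem integrable_and_integral_integrandC (hcubic : χ ^ 3 = 1) (hm : ¬ p ∣ m)
    (he : e ≠ 0) (h1 : p ∣ p ^ e) (h2 : p ^ 2 ∣ p ^ e)
    {a : Form (ZMod (p ^ e))} (hreg : IsRegular h1 h2 a) {N D : ℂ}
    (ha : HasRootDensities (reduce h1 a) N D) :
    Integrable (integrandC p e a χ) (prodHaar p 3) ∧
      ∫ z, integrandC p e a χ z ∂(prodHaar p 3) = ((p : ℂ) ^ (3 * e))⁻¹ *
        (leadDensity a 1 + frobRoot p χ * leadDensity a p +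
          frobRoot p χ ^ 2 * leadDensity a 0 * (1 - frobRoot p χ)⁻¹) := by
  have hω := norm_frobRoot_lt_one (p := p) hcubic hm
  obtain ⟨hs, ht⟩ := summable_and_tsum_eventually_geometric hω
    (Q := fun k => leadDensity a ((p : ZMod (p ^ e)) ^ k)) (c := leadDensity a 0) fun k hk => by
      rw [leadDensity_eq_of_sq_dvd h2 ha hreg (map_zero _), leadDensity_eq_of_sq_dvd h2 ha hreg]
      rw [castHom_eq_zero_iff, Nat.cast_pow]
      exact pow_dvd_pow _ hk
  rw [pow_zero, pow_one] at ht
  rw [← ht]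
  refine integrable_and_integral_prodHaar p 3 hω
    (fun s c => orbitDensity a ![s, c 0, c 1, c 2]) _
    (fun t s u hts => integrandC_coe hcubic hm he a t s u hts) ?_ _ ?_ hs
  · intro t u hΨ
    by_contra hcon
    refine hΨ (mul_eq_zero_of_right _ (average_eq_zero p χ⁻¹ a ?_))
    rintro ⟨y, hy⟩
    refine hcon ⟨⟨y 0, congrFun hy 0⟩, ![y 1, y 2, y 3], ?_⟩
    ext i
    fin_cases i
    · exact congrFun hy 1
    · exact congrFun hy 2
    · exact congrFun hy 3
  · intro s hs0
    rw [sum_orbitDensity_three, leadDensity_toZModPow a hs0]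

end Character

theorem integrandB_coe (he : e ≠ 0) (a : Form (ZMod (p ^ e))) (t : ℚ_[p]ˣ) (s : ℤ_[p])
    (u : Fin 2 → ℤ_[p]) (hts : (t : ℚ_[p]) = s) :
    integrandB p e a (t, fun i => (u i : ℚ_[p])) = (((p : ℂ) ^ 2)⁻¹) ^ s.valuation *
      orbitDensity a ![0, PadicInt.toZModPow e s, PadicInt.toZModPow e (u 0),
        PadicInt.toZModPow e (u 1)] := by
  have hs0 : s ≠ 0 := by
    rintro rfl
    simp at hts
  have hx : (![0, (t : ℚ_[p]), (u 0 : ℚ_[p]), (u 1 : ℚ_[p])] : Form ℚ_[p]) =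
      fun i => ((![0, s, u 0, u 1] : Form ℤ_[p]) i : ℚ_[p]) := by
    ext i
    fin_cases i
    · rfl
    · exact hts
    · rfl
    · rfl
  simp only [integrandB]
  rw [hx, average_coe p _ hp.out.not_dvd_one he, hts, ← PadicInt.norm_def,
    PadicInt.norm_eq_zpow_neg_valuation hs0]
  congr 1
  · push_cast
    rw [zpow_neg, zpow_natCast, inv_pow, inv_pow, ← pow_mul, ← pow_mul, mul_comm]
  · congr 1
    ext i
    fin_cases i
    · exact map_zero _
    · rfl
    · rfl
    · rfl

theorem integrable_and_integral_integrandB (he : e ≠ 0) (h1 : p ∣ p ^ e) (h2 : p ^ 2 ∣ p ^ e)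
    {a : Form (ZMod (p ^ e))} (hreg : IsRegular h1 h2 a) :
    Integrable (integrandB p e a) (prodHaar p 2) ∧
      ∫ z, integrandB p e a z ∂(prodHaar p 2) = ((p : ℂ) ^ (2 * e))⁻¹ *
        (leadDensity a 0 / ((p : ℂ) ^ e - (p : ℂ) ^ e / p)) := by
  have hη : ‖((p : ℂ) ^ 2)⁻¹‖ < 1 := by
    rw [norm_inv, norm_pow, Complex.norm_natCast]
    exact inv_lt_one_of_one_lt₀ (one_lt_pow₀ (Nat.one_lt_cast.2 hp.out.one_lt) two_ne_zero)
  have hX : (p : ℂ) ^ e - (p : ℂ) ^ e / p ≠ 0 := by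
    rw [← card_units_zmod h1]
    exact Nat.cast_ne_zero.2 Nat.card_pos.ne'
  obtain ⟨hs, ht⟩ := summable_and_tsum_eventually_geometric hη
    -- Only the shell $v(t)=0$ survives, because the coefficient `t` has to be a unit.
    (Q := fun k => if k = 0 then leadDensity a 0 / ((p : ℂ) ^ e - (p : ℂ) ^ e / p) else 0) (c := 0)
    fun k hk => if_neg (by omega)
  simp only [if_true, one_ne_zero, if_false, mul_zero, zero_mul, add_zero] at ht
  rw [← ht]
  refine integrable_and_integral_prodHaar p 2 hη
    (fun s c => orbitDensity a ![0, s, c 0, c 1]) _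
    (fun t s u hts => integrandB_coe he a t s u hts) ?_ _ ?_ hs
  · intro t u hΨ
    by_contra hcon
    refine hΨ (mul_eq_zero_of_right _ (average_eq_zero p _ a ?_))
    rintro ⟨y, hy⟩
    refine hcon ⟨⟨y 1, congrFun hy 1⟩, ![y 2, y 3], ?_⟩
    ext i
    fin_cases i
    · exact congrFun hy 2
    · exact congrFun hy 3
  · intro s hs0
    by_cases hv : s.valuation = 0
    · rw [if_pos hv, eq_div_iff hX, mul_comm]
      exact sum_orbitDensity_two_of_isUnit hreg ((isUnit_toZModPow_iff he hs0).2 hv)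
    · rw [if_neg hv]
      exact sum_orbitDensity_two_of_not_isUnit hreg (mt (isUnit_toZModPow_iff he hs0).1 hv)

theorem localB_eq (he : e ≠ 0) (h1 : p ∣ p ^ e) (h2 : p ^ 2 ∣ p ^ e)
    {a : Form (ZMod (p ^ e))} (hreg : IsRegular h1 h2 a) {N D : ℂ}
    (ha : HasRootDensities (reduce h1 a) N D) : localB p e a = N := by
  rw [localB, (integrable_and_integral_integrandB he h1 h2 hreg).2,
    leadDensity_eq_of_sq_dvd h2 ha hreg (map_zero _), mul_comm 4, mul_comm 2, pow_mul, pow_mul]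
  have hX : (p : ℂ) ^ e ≠ 0 := pow_ne_zero _ (Nat.cast_ne_zero.2 hp.out.ne_zero)
  generalize (p : ℂ) ^ e = X at hX
  have hp0 : (p : ℂ) ≠ 0 := Nat.cast_ne_zero.2 hp.out.ne_zero
  have hp1 : (p : ℂ) - 1 ≠ 0 := sub_ne_zero.2 (Nat.cast_ne_one.2 hp.out.ne_one)
  have hp2 : (p : ℂ) + 1 ≠ 0 := Nat.cast_add_one_ne_zero p
  rw [show X - X / p = X * (p - 1) / p by field_simp]
  field_simp
  ring

/-- After multiplication by $1-\omega$, the simple roots contribute through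
$(1-\omega)\omega+\omega^2=\omega$. Non-roots keep the factor $1-\omega$ and multiple roots keep
$(1-\omega)\omega$. -/
theorem localC_eq {χ : DirichletCharacter ℂ m} (hcubic : χ ^ 3 = 1) (hm : ¬ p ∣ m) (he : e ≠ 0)
    (h1 : p ∣ p ^ e) (h2 : p ^ 2 ∣ p ^ e) {a : Form (ZMod (p ^ e))} (hreg : IsRegular h1 h2 a)
    {N D : ℂ} (ha : HasRootDensities (reduce h1 a) N D) :
    (1 - ((p : ℂ) ^ 2)⁻¹) * localC p e a χ =
      (p : ℂ)⁻¹ * ((1 - frobRoot p χ) * (p + 1 - N - D) +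
        (1 - frobRoot p χ) * frobRoot p χ * D * p + N * (p - 1) * frobRoot p χ) := by
  rw [localC, (integrable_and_integral_integrandC hcubic hm he h1 h2 hreg ha).2,
    localL_inv hcubic hm, leadDensity_eq_of_sq_dvd h2 ha hreg (map_zero _),
    leadDensity_prime h2 ha hreg, mul_comm 4, mul_comm 3, pow_mul, pow_mul]
  have hω : 1 - frobRoot p χ ≠ 0 := by
    rw [sub_ne_zero]
    intro h
    have := norm_frobRoot_lt_one (p := p) hcubic hm
    rw [← h, norm_one] at this
    exact lt_irrefl _ this
  have hone := leadDensity_one ha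
  have hX : (p : ℂ) ^ e ≠ 0 := pow_ne_zero _ (Nat.cast_ne_zero.2 hp.out.ne_zero)
  generalize (p : ℂ) ^ e = X at hX hone
  generalize frobRoot p χ = ω at hω
  have hp0 : (p : ℂ) ≠ 0 := Nat.cast_ne_zero.2 hp.out.ne_zero
  have hp1 : (p : ℂ) - 1 ≠ 0 := sub_ne_zero.2 (Nat.cast_ne_one.2 hp.out.ne_one)
  have hp2 : (p : ℂ) + 1 ≠ 0 := Nat.cast_add_one_ne_zero p
  have hX1 : X - X / p = X * (p - 1) / p := by field_simp
  have hX2 : X / p - X / p ^ 2 = X * (p - 1) / p ^ 2 := by field_simp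
  rw [hX1] at hone
  have hone' : leadDensity a 1 = (1 - (N + D) * ((p : ℂ) + 1)⁻¹) / (X * (p - 1) / p) := by
    rw [← hone, mul_div_cancel_left₀]
    exact div_ne_zero (mul_ne_zero hX hp1) hp0
  rw [hone', hX2]
  field_simp
  ring

/-! ### Specialisation to the five types -/

theorem HasType.localB_eq (he : 2 ≤ e) {a : Form (ZMod (p ^ e))} {σ : MaxType}
    (ha : HasType he a σ) : localB p e a = σ.simpleRoots := by
  have h1 : p ∣ p ^ e := dvd_pow_self p (by omega)
  have h2 : p ^ 2 ∣ p ^ e := pow_dvd_pow p he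
  obtain ⟨hreg, hN⟩ := ha.isRegular_and_hasRootDensities he h1 h2
  exact CubicFormResidue.localB_eq (by omega) h1 h2 hreg hN

theorem HasType.localC_eq {χ : DirichletCharacter ℂ m} (hcubic : χ ^ 3 = 1) (hm : ¬ p ∣ m)
    (he : 2 ≤ e) {a : Form (ZMod (p ^ e))} {σ : MaxType} (ha : HasType he a σ) :
    (1 - ((p : ℂ) ^ 2)⁻¹) * localC p e a χ =
      (p : ℂ)⁻¹ * ((1 - frobRoot p χ) * (p + 1 - σ.simpleRoots - σ.multipleRoots) +
        (1 - frobRoot p χ) * frobRoot p χ * σ.multipleRoots * p +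
          σ.simpleRoots * (p - 1) * frobRoot p χ) := by
  have h1 : p ∣ p ^ e := dvd_pow_self p (by omega)
  have h2 : p ^ 2 ∣ p ^ e := pow_dvd_pow p he
  obtain ⟨hreg, hN⟩ := ha.isRegular_and_hasRootDensities he h1 h2
  exact CubicFormResidue.localC_eq hcubic hm (by omega) h1 h2 hreg hN

theorem HasType.integrable {χ : DirichletCharacter ℂ m} (hcubic : χ ^ 3 = 1) (hm : ¬ p ∣ m)
    (he : 2 ≤ e) {a : Form (ZMod (p ^ e))} {σ : MaxType} (ha : HasType he a σ) :
    Integrable (integrandB p e a) (prodHaar p 2) ∧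
      Integrable (integrandC p e a χ) (prodHaar p 3) := by
  have h1 : p ∣ p ^ e := dvd_pow_self p (by omega)
  have h2 : p ^ 2 ∣ p ^ e := pow_dvd_pow p he
  obtain ⟨hreg, hN⟩ := ha.isRegular_and_hasRootDensities he h1 h2
  exact ⟨(integrable_and_integral_integrandB (by omega) h1 h2 hreg).1,
    (integrable_and_integral_integrandC hcubic hm (by omega) h1 h2 hreg hN).1⟩

end Evaluation

end CubicFormResidue

open CubicFormResidue in
theorem mainTheorem8 (p : ℕ) [Fact p.Prime] (m : ℕ) [NeZero m] (χ : DirichletCharacter ℂ m)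
    (hprim : χ.IsPrimitive) (hcubic : χ ^ 3 = 1) (hunram : ¬ p ∣ m)
    (e : ℕ) (he : 2 ≤ e) :
    (∀ a : Form (ZMod (p ^ e)), IsMaximal he a →
      MeasureTheory.Integrable (integrandB p e a) (prodHaar p 2) ∧
      MeasureTheory.Integrable (integrandC p e a χ) (prodHaar p 3) ∧
      (HasType he a .t3 →
        localB p e a = 0 ∧
        (1 - ((p : ℂ) ^ 2)⁻¹) * localC p e a χ =
          (1 - χ p ^ 2 * (p : ℂ) ^ (-(1 / 3) : ℂ)) * (1 + (p : ℂ)⁻¹)) ∧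
      (HasType he a .t21 →
        localB p e a = 1 ∧
        (1 - ((p : ℂ) ^ 2)⁻¹) * localC p e a χ =
          1 - χ p ^ 2 * (p : ℂ) ^ (-(4 / 3) : ℂ)) ∧
      (HasType he a .t111 →
        localB p e a = 3 ∧
        (1 - ((p : ℂ) ^ 2)⁻¹) * localC p e a χ =
          (1 - χ p * (p : ℂ) ^ (-(2 / 3) : ℂ)) *
            (1 + χ p ^ 2 * (p : ℂ) ^ (-(1 / 3) : ℂ)) ^ 2) ∧
      (HasType he a .t121max →
        localB p e a = 1 ∧
        (1 - ((p : ℂ) ^ 2)⁻¹) * localC p e a χ =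
          (1 + χ p ^ 2 * (p : ℂ) ^ (-(1 / 3) : ℂ)) *
            (1 - χ p * (p : ℂ) ^ (-(2 / 3) : ℂ))) ∧
      (HasType he a .t13max →
        localB p e a = 0 ∧
        (1 - ((p : ℂ) ^ 2)⁻¹) * localC p e a χ =
          1 - χ p * (p : ℂ) ^ (-(2 / 3) : ℂ))) ∧
    (∀ (σ : MaxType) (a a' : Form (ZMod (p ^ e))), HasType he a σ → HasType he a' σ →
      localB p e a = localB p e a' ∧ localC p e a χ = localC p e a' χ) := by
  have hp0 : (p : ℂ) ≠ 0 := Nat.cast_ne_zero.2 (Fact.out : p.Prime).ne_zero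
  have hω3 := frobRoot_pow_three (p := p) hcubic hunram
  have hω2 := frobRoot_sq (p := p) hcubic hunram
  have hω3' : frobRoot p χ ^ 3 * p = 1 := by rw [hω3, inv_mul_cancel₀ hp0]
  have hω4 : χ p ^ 2 * (p : ℂ) ^ (-(4 / 3) : ℂ) = (p : ℂ)⁻¹ * frobRoot p χ := by
    rw [cpow_neg_four_thirds, frobRoot]
    ring
  refine ⟨fun a ha => ?_, fun σ a a' ha ha' => ⟨?_, ?_⟩⟩
  · obtain ⟨σ, hσ⟩ := ha
    obtain ⟨hB, hC⟩ := hσ.integrable hcubic hunram he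
    refine ⟨hB, hC, fun h => ⟨h.localB_eq he, ?_⟩, fun h => ⟨h.localB_eq he, ?_⟩,
      fun h => ⟨h.localB_eq he, ?_⟩, fun h => ⟨h.localB_eq he, ?_⟩, fun h => ⟨h.localB_eq he, ?_⟩⟩
    · rw [h.localC_eq hcubic hunram he]
      change _ = (1 - frobRoot p χ) * _
      simp only [MaxType.simpleRoots, MaxType.multipleRoots]
      field_simp
      ring
    · rw [h.localC_eq hcubic hunram he, hω4]
      simp only [MaxType.simpleRoots, MaxType.multipleRoots]
      field_simp
      ring
    · rw [h.localC_eq hcubic hunram he, ← hω2]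
      change _ = _ * (1 + frobRoot p χ) ^ 2
      simp only [MaxType.simpleRoots, MaxType.multipleRoots]
      field_simp
      -- After multiplication by $p$ the two sides differ by $(2+\omega)(p\omega^3-1)$.
      linear_combination (2 + frobRoot p χ) * hω3'
    · rw [h.localC_eq hcubic hunram he, ← hω2]
      change _ = (1 + frobRoot p χ) * _
      simp only [MaxType.simpleRoots, MaxType.multipleRoots]
      field_simp
      -- Here the difference is $p\omega^3-1$.
      linear_combination hω3'
    · rw [h.localC_eq hcubic hunram he, ← hω2]
      simp only [MaxType.simpleRoots, MaxType.multipleRoots]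
      field_simp
      ring
  · rw [ha.localB_eq he, ha'.localB_eq he]
  · have h1 : (1 - ((p : ℂ) ^ 2)⁻¹) ≠ 0 := by
      have hp1 : (1 : ℝ) < p := Nat.one_lt_cast.2 (Fact.out : p.Prime).one_lt
      rw [sub_ne_zero, Ne, eq_comm, inv_eq_one]
      exact_mod_cast (one_lt_pow₀ hp1 two_ne_zero).ne'
    apply mul_left_cancel₀ h1
    rw [ha.localC_eq hcubic hunram he, ha'.localC_eq hcubic hunram he]
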